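/- **Theorem 5.1 (sufficient conditions for a continuous objective and adjoint gradient).** *Setting.* A platoon consists of vehicles $i=1,\dots,n$ with states $x_i(t)\in\mathbb R^d$ (first coordinate: position; the others: velocity-like; $d=2$ for second order models), times $t_i\le S_i\le T_i$ (entry, end of the known lead trajectory — usually written $T_{i-1}$ — and exit), continuous measured trajectories $\hat x_i:[t_i,T_i]\to\mathbb R^d$ and parameters $p=(p_1,\dots,p_n)$, $p_i\in P_i\subseteq\mathbb R^{m_i}$; put $P=\prod_i P_i$. On $[t_i,S_i]$ the leader $L(i,t)$ is either a platoon vehicle present at time $t$ or an external vehicle. It changes finitely often, the leader relation at each time is acyclic, and external lead trajectories are piecewise continuous (finitely many discontinuities, finite one-sided limits). The car-following model $h_i$ has finitely many regimes $h_{i,r}(x_i,x_{L(i)},p_i)$, and a switching rule depending on $(x_i,x_{L(i)},p_i)$ selects the regime in force. The loss $f(x_i,\hat x_i,t)$ likewise has finitely many regimes $f_s$ selected by a rule depending on $(x_i,\hat x_i,t)$. Partial derivatives of $h_i$, $f$ along a trajectory are those of the regime in force. *Simulated trajectories for $p$:* $x_i(t)=\hat x_i(t_i)+\int_{t_i}^t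 h_i(x_i,x_{L(i)},p_i)\,ds$ on $[t_i,S_i]$. On $(S_i,T_i]$ the position is $x_i^*(t)=x_i^*(S_i)+\hat x_i^*(t)-\hat x_i^*(S_i)$ and the remaining coordinates equal those of $\hat x_i(t)$ (the boundary condition $\dot x_i=\dot{\hat x}_i$ after the velocity jumps to the measured one). *Objective, adjoint, adjoint gradient:* $$F(p)=\sum_{i=1}^n\int_{t_i}^{S_i} f(x_i,\hat x_i,t)\,dt,$$ $$\dot\lambda_i^T=\mathbb 1(t\le S_i)\Big(\frac{\partial f}{\partial x_i}-\lambda_i^T\frac{\partial h_i}{\partial x_i}\Big)-\sum_{k:\ L(k,t)=i,\ t\in[t_k,S_k]}\lambda_k^T\frac{\partial h_k}{\partial x_{L(k)}}\quad\text{on }[t_i,T_i],\qquad \lambda_i(T_i)=0$$ (in integrated form; the sum has at most one term if $i$ has at most one follower), and $\frac{dF}{dp}$ denotes the adjoint gradient, whose block for vehicle $i$ is $-\int_{t_i}^{S_i}\lambda_i^T\frac{\partial h_i}{\partial p_i}\,dt$. *Hypotheses.* 1. Each regime $f_s$ is continuous on $\mathbb R^d\times\mathbb R^d\times[t_i,S_i]$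 for all $i$, differentiable in $x_i$, and $\partial f_s/\partial x_i$ is continuous there. 2. Each regime $h_{i,r}$ is continuous on $\mathbb R^d\times\mathbb R^d\times P_i$, and its partial derivatives with respect to $x_i$, $x_{L(i)}$ and $p_i$ exist and are continuous there. 3. The derivatives $\partial h_{i,r}/\partial x_i$ are bounded by a constant, uniformly in $r$ and in the states and locally uniformly in $p_i\in P_i$. 4. The switching times depend continuously on the parameters: for every $p^0\in P$ there are finitely many functions $\theta_0\le\dots\le\theta_N$ of $p$, continuous at $p^0$ within $P$, with $\theta_0\le t_i$ and $S_i\le\theta_N$ for all $i$, and regimes $\rho_{i,j}$ (of $h_i$) and $\sigma_{i,j}$ (of $f$ for vehicle $i$), independent of $p$, such that for all $p\in P$ near $p^0$ the regimes in force on $(\theta_j(p),\theta_{j+1}(p))\cap[t_i,S_i]$ are $\rho_{i,j}$ and $\sigma_{i,j}$. Here the regimes in force are those selected by the switching rules, both along every simulated trajectory and along every solution obtained by prescribing the regimes $\rho_{i,j}$ on these intervals. The $h_{i,r}$ and the $f_s$ need not agree where regimes switch, so that $h_i$ may jump at regime and at lane changes. *Conclusion.* For every $p\in P$ the simulated trajectories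 and the adjoint variables exist and are unique on $[t_i,T_i]$, the integrals defining $F$ and $dF/dp$ exist, and $p\mapsto F(p)$ and $p\mapsto \frac{dF}{dp}(p)$ are continuous on $P$. -/

import Mathlib

open Set Filter Topology MeasureTheory

noncomputable section

/-- State of a vehicle. Coordinate `0` is the position and the other coordinates, if any, are
velocity-like: `d = 2` is a second order model with state (position, velocity), `d = 1` a first
order model. -/
abbrev VState (d : ℕ) : Type := EuclideanSpace ℝ (Fin d)

/-- Piecewise continuity on `[a, b]`: continuity (relative to `[a, b]`) except at finitely many
points, with finite one-sided limits everywhere. -/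
def PiecewiseContOn {E : Type*} [TopologicalSpace E] (φ : ℝ → E) (a b : ℝ) : Prop :=
  (∃ s : Set ℝ, s.Finite ∧ ∀ t ∈ Icc a b, t ∉ s → ContinuousWithinAt φ (Icc a b) t) ∧
  ∀ t ∈ Icc a b,
    (∃ l, Tendsto φ (𝓝[Icc a b ∩ Iio t] t) (𝓝 l)) ∧
    (∃ l, Tendsto φ (𝓝[Icc a b ∩ Ioi t] t) (𝓝 l))

/-- The data of the calibration problem for a platoon of `n` vehicles. -/
structure Platoon (n d : ℕ) where
  /-- number of parameters of each vehicle -/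
  nPar : Fin n → ℕ
  /-- number of regimes of the car-following model of each vehicle -/
  nReg : Fin n → ℕ
  /-- `model i r x y q`: regime `r` of the model of vehicle `i`, a function of its own state `x`,
  the state `y` of its leader and its own parameters `q` -/
  model : (i : Fin n) → Fin (nReg i) → VState d → VState d →
    EuclideanSpace ℝ (Fin (nPar i)) → VState d
  /-- switching rule: the regime in force for given own state, leader state and parameters
  (for two regimes and a switching function `g` this is `if 0 ≤ g x y q then 1 else 0`) -/
  select : (i : Fin n) → VState d → VState d → EuclideanSpace ℝ (Fin (nPar i)) → Fin (nReg i)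
  /-- number of regimes of the loss function -/
  nLoss : ℕ
  /-- `loss s x z t`: regime `s` of the loss for simulated state `x`, measured state `z`, time `t` -/
  loss : Fin nLoss → VState d → VState d → ℝ → ℝ
  /-- switching rule of the loss function -/
  lossSelect : VState d → VState d → ℝ → Fin nLoss
  /-- time at which the vehicle enters -/
  tStart : Fin n → ℝ
  /-- time until which the lead trajectory of the vehicle is known -/
  tLead : Fin n → ℝ
  /-- time at which the vehicle leaves -/
  tEnd : Fin n → ℝ
  /-- measured trajectories -/
  data : Fin n → ℝ → VState d
  /-- `leader i t` is the platoon vehicle that leads vehicle `i` at time `t`, and `none` if the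
  leader does not belong to the platoon -/
  leader : Fin n → ℝ → Option (Fin n)
  /-- trajectory of the leader of vehicle `i` while that leader is not in the platoon -/
  extLead : Fin n → ℝ → VState d

namespace Platoon

variable {n d : ℕ}

/-- Parameters of vehicle `i`. -/
abbrev Par (D : Platoon n d) (i : Fin n) : Type := EuclideanSpace ℝ (Fin (D.nPar i))

/-- The concatenated parameter vector `p = (p_1, …, p_n)`. -/
abbrev Params (D : Platoon n d) : Type := (i : Fin n) → D.Par i

/-- The set of admissible `p` when the parameters of vehicle `i` range over `P i`. -/
abbrev feasible (D : Platoon n d) (P : (i : Fin n) → Set (D.Par i)) : Set D.Params :=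
  Set.pi Set.univ P

/-- The lead trajectory of vehicle `i`, for platoon trajectories `x`. -/
def lead (D : Platoon n d) (x : Fin n → ℝ → VState d) (i : Fin n) (t : ℝ) : VState d :=
  (D.leader i t).elim (D.extLead i t) (fun k => x k t)

/-- The regime of the model of vehicle `i` that is in force at time `t` along `x`. -/
def activeRegime (D : Platoon n d) (p : D.Params) (x : Fin n → ℝ → VState d)
    (i : Fin n) (t : ℝ) : Fin (D.nReg i) :=
  D.select i (x i t) (D.lead x i t) (p i)

/-- The regime of the loss of vehicle `i` that is in force at time `t` along `x`. -/
def activeLoss (D : Platoon n d) (x : Fin n → ℝ → VState d) (i : Fin n) (t : ℝ) :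
    Fin D.nLoss :=
  D.lossSelect (x i t) (D.data i t) t

/-- `x` solves the platoon equations with parameters `p` when vehicle `i` runs in regime `r i t` at
time `t`. On `[tStart i, tLead i]` it starts at the measured state and solves the differential
equation `x' = h` in integrated form. On `(tLead i, tEnd i]` it obeys the downstream boundary
condition `x' = (data)'`, also integrated: the position is continuous at `tLead i` and has the same
increments as the measured position, while the velocity-like coordinates jump to the measured ones
and stay equal to them. -/
def Solves [NeZero d] (D : Platoon n d) (p : D.Params) (r : (i : Fin n) → ℝ → Fin (D.nReg i))
    (x : Fin n → ℝ → VState d) : Prop :=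
  ∀ i : Fin n,
    IntervalIntegrable (fun s => D.model i (r i s) (x i s) (D.lead x i s) (p i)) volume
      (D.tStart i) (D.tLead i) ∧
    (∀ t ∈ Icc (D.tStart i) (D.tLead i),
      x i t = D.data i (D.tStart i) +
        ∫ s in (D.tStart i)..t, D.model i (r i s) (x i s) (D.lead x i s) (p i)) ∧
    (∀ t ∈ Ioc (D.tLead i) (D.tEnd i), ∀ k : Fin d,
      x i t k = if k = 0 then x i (D.tLead i) 0 + (D.data i t 0 - D.data i (D.tLead i) 0)
        else D.data i t k)

/-- `x` are simulated trajectories for the parameters `p`: at each time each vehicle runs in the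
regime that its own switching rule selects. -/
def IsSimulated [NeZero d] (D : Platoon n d) (p : D.Params) (x : Fin n → ℝ → VState d) : Prop :=
  D.Solves p (D.activeRegime p x) x

/-- `∂f/∂x_i` along `x`, for the regime of the loss that is in force. -/
def lossDx (D : Platoon n d) (x : Fin n → ℝ → VState d) (i : Fin n) (t : ℝ) :
    VState d →L[ℝ] ℝ :=
  fderiv ℝ (fun z => D.loss (D.activeLoss x i t) z (D.data i t) t) (x i t)

/-- `∂h_i/∂x_i` along `x`, for the regime of the model that is in force. -/
def modelDx (D : Platoon n d) (p : D.Params) (x : Fin n → ℝ → VState d) (i : Fin n) (t : ℝ) :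
    VState d →L[ℝ] VState d :=
  fderiv ℝ (fun z => D.model i (D.activeRegime p x i t) z (D.lead x i t) (p i)) (x i t)

/-- `∂h_i/∂x_{L(i)}` along `x`, for the regime of the model that is in force. -/
def modelDlead (D : Platoon n d) (p : D.Params) (x : Fin n → ℝ → VState d) (i : Fin n) (t : ℝ) :
    VState d →L[ℝ] VState d :=
  fderiv ℝ (fun y => D.model i (D.activeRegime p x i t) (x i t) y (p i)) (D.lead x i t)

/-- `∂h_i/∂p_i` along `x`, for the regime of the model that is in force. -/
def modelDpar (D : Platoon n d) (p : D.Params) (x : Fin n → ℝ → VState d) (i : Fin n) (t : ℝ) :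
    D.Par i →L[ℝ] VState d :=
  fderiv ℝ (fun q => D.model i (D.activeRegime p x i t) (x i t) (D.lead x i t) q) (p i)

/-- The integrand `f(x_i, data_i, t)` of the objective. -/
def lossAlong (D : Platoon n d) (x : Fin n → ℝ → VState d) (i : Fin n) (t : ℝ) : ℝ :=
  D.loss (D.activeLoss x i t) (x i t) (D.data i t) t

/-- The objective `F`. -/
def objective (D : Platoon n d) (x : Fin n → ℝ → VState d) : ℝ :=
  ∑ i : Fin n, ∫ t in (D.tStart i)..(D.tLead i), D.lossAlong x i t

/-- Vehicle `k` follows vehicle `i` at time `t` according to its car-following model. -/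
def Follows (D : Platoon n d) (k i : Fin n) (t : ℝ) : Prop :=
  D.leader k t = some i ∧ t ∈ Icc (D.tStart k) (D.tLead k)

open Classical in
/-- The right hand side of the adjoint system `λ_i' = …`. The adjoint variables are row vectors
(linear functionals), so that `λᵀ A` is `λ.comp A`. A follower of `i` within the platoon contributes
`λ_kᵀ ∂h_k/∂x_i`; there is at most one such term when vehicles have at most one follower. -/
def adjointRhs (D : Platoon n d) (p : D.Params) (x : Fin n → ℝ → VState d)
    (lam : Fin n → ℝ → (VState d →L[ℝ] ℝ)) (i : Fin n) (t : ℝ) : VState d →L[ℝ] ℝ :=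
  (if t ≤ D.tLead i then D.lossDx x i t - (lam i t).comp (D.modelDx p x i t) else 0)
    - ∑ k : Fin n, if D.Follows k i t then (lam k t).comp (D.modelDlead p x k t) else 0

/-- `lam` solves the adjoint system along `x`, backwards from `lam i (tEnd i) = 0`, in integrated
form. -/
def IsAdjoint (D : Platoon n d) (p : D.Params) (x : Fin n → ℝ → VState d)
    (lam : Fin n → ℝ → (VState d →L[ℝ] ℝ)) : Prop :=
  ∀ i : Fin n,
    IntervalIntegrable (D.adjointRhs p x lam i) volume (D.tStart i) (D.tEnd i) ∧
    ∀ t ∈ Icc (D.tStart i) (D.tEnd i), lam i t = ∫ s in (D.tEnd i)..t, D.adjointRhs p x lam i s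

/-- The integrand `λ_iᵀ ∂h_i/∂p_i` of the adjoint gradient. -/
def gradAlong (D : Platoon n d) (p : D.Params) (x : Fin n → ℝ → VState d)
    (lam : Fin n → ℝ → (VState d →L[ℝ] ℝ)) (i : Fin n) (t : ℝ) : D.Par i →L[ℝ] ℝ :=
  (lam i t).comp (D.modelDpar p x i t)

/-- The adjoint gradient `dF/dp`. Since `h_i` depends on `p` through `p_i` only, its block for
vehicle `i` is `- ∫ λ_iᵀ ∂h_i/∂p_i dt`. -/
def adjointGradient (D : Platoon n d) (p : D.Params) (x : Fin n → ℝ → VState d)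
    (lam : Fin n → ℝ → (VState d →L[ℝ] ℝ)) : (i : Fin n) → (D.Par i →L[ℝ] ℝ) :=
  fun i => - ∫ t in (D.tStart i)..(D.tLead i), D.gradAlong p x lam i t

/-- What the calibration problem takes for granted about times, leaders and measurements. -/
structure Admissible (D : Platoon n d) : Prop where
  start_le_lead : ∀ i, D.tStart i ≤ D.tLead i
  lead_le_end : ∀ i, D.tLead i ≤ D.tEnd i
  /-- the measured trajectories are continuous -/
  data_cont : ∀ i, ContinuousOn (D.data i) (Icc (D.tStart i) (D.tEnd i))
  /-- the lead trajectories from outside the platoon are piecewise continuous -/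
  ext_cont : ∀ i, PiecewiseContOn (D.extLead i) (D.tStart i) (D.tLead i)
  /-- each vehicle changes its leader finitely many times -/
  leader_changes : ∀ i, ∃ s : Set ℝ, s.Finite ∧ ∀ t ∈ Icc (D.tStart i) (D.tLead i), t ∉ s →
    ∀ᶠ τ in 𝓝[Icc (D.tStart i) (D.tLead i)] t, D.leader i τ = D.leader i t
  /-- a leader within the platoon is present while it leads -/
  leader_present : ∀ i k t, D.Follows i k t → t ∈ Icc (D.tStart k) (D.tEnd k)
  /-- at each time the vehicles can be ordered from downstream to upstream -/
  leader_order : ∀ t, ∃ rank : Fin n → ℕ, ∀ i k, D.Follows i k t → rank k < rank i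

/-- The loss function and `∂f/∂x` are piecewise continuous: this is the continuity of each regime;
for the switching times see `SwitchingContinuous`. -/
structure LossRegular (D : Platoon n d) : Prop where
  cont : ∀ i s, ContinuousOn (fun w : VState d × VState d × ℝ => D.loss s w.1 w.2.1 w.2.2)
    (univ ×ˢ univ ×ˢ Icc (D.tStart i) (D.tLead i))
  diff : ∀ i s x z, ∀ t ∈ Icc (D.tStart i) (D.tLead i),
    DifferentiableAt ℝ (fun x' => D.loss s x' z t) x
  cont_dx : ∀ i s, ContinuousOn
    (fun w : VState d × VState d × ℝ => fderiv ℝ (fun x' => D.loss s x' w.2.1 w.2.2) w.1)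
    (univ ×ˢ univ ×ˢ Icc (D.tStart i) (D.tLead i))

/-- The model and its partial derivatives are piecewise continuous: this is the continuity of each
regime; for the switching times see `SwitchingContinuous`. -/
structure ModelRegular (D : Platoon n d) (P : (i : Fin n) → Set (D.Par i)) : Prop where
  cont : ∀ i r, ContinuousOn
    (fun w : VState d × VState d × D.Par i => D.model i r w.1 w.2.1 w.2.2)
    (univ ×ˢ univ ×ˢ P i)
  diff_x : ∀ i r x y, ∀ q ∈ P i, DifferentiableAt ℝ (fun x' => D.model i r x' y q) x
  diff_lead : ∀ i r x y, ∀ q ∈ P i, DifferentiableAt ℝ (fun y' => D.model i r x y' q) y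
  diff_par : ∀ i r x y, ∀ q ∈ P i, DifferentiableAt ℝ (fun q' => D.model i r x y q') q
  cont_dx : ∀ i r, ContinuousOn (fun w : VState d × VState d × D.Par i =>
    fderiv ℝ (fun x' => D.model i r x' w.2.1 w.2.2) w.1) (univ ×ˢ univ ×ˢ P i)
  cont_dlead : ∀ i r, ContinuousOn (fun w : VState d × VState d × D.Par i =>
    fderiv ℝ (fun y' => D.model i r w.1 y' w.2.2) w.2.1) (univ ×ˢ univ ×ˢ P i)
  cont_dpar : ∀ i r, ContinuousOn (fun w : VState d × VState d × D.Par i =>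
    fderiv ℝ (fun q' => D.model i r w.1 w.2.1 q') w.2.2) (univ ×ˢ univ ×ˢ P i)

/-- `∂h_i/∂x_i` is bounded by a constant, which may be chosen locally in the parameters. -/
def DxBounded (D : Platoon n d) (P : (i : Fin n) → Set (D.Par i)) : Prop :=
  ∀ i, ∀ q₀ ∈ P i, ∃ C : ℝ, ∀ᶠ q in 𝓝[P i] q₀, ∀ r x y,
    ‖fderiv ℝ (fun x' => D.model i r x' y q) x‖ ≤ C

/-- The regime signal `r` is the one of a schedule: it equals `ρ i j` between the `j`-th and the
`(j+1)`-st switching time (at the switching times themselves it is arbitrary). -/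
def OnSchedule (D : Platoon n d) {N : ℕ} (θ : Fin (N + 1) → ℝ) {K : Fin n → ℕ}
    (ρ : (i : Fin n) → Fin N → Fin (K i)) (r : (i : Fin n) → ℝ → Fin (K i)) : Prop :=
  ∀ i (j : Fin N), ∀ t ∈ Ioo (θ j.castSucc) (θ j.succ), t ∈ Icc (D.tStart i) (D.tLead i) →
    r i t = ρ i j

/-- The switching times depend continuously on the parameters. Near each `p₀` there are finitely
many times `θ 0 p ≤ … ≤ θ N p`, continuous at `p₀`, such that the regimes between consecutive times
are the same ones (`ρ` for the models, `σ` for the loss) for all `p` near `p₀`. That these are the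
switching times of the platoon means: the solution that runs through the regimes of the schedule is
one for which the switching rules select exactly these regimes, and so is every simulated
trajectory. -/
def SwitchingContinuous [NeZero d] (D : Platoon n d) (P : (i : Fin n) → Set (D.Par i)) : Prop :=
  ∀ p₀ ∈ D.feasible P, ∃ (N : ℕ) (θ : Fin (N + 1) → D.Params → ℝ)
    (ρ : (i : Fin n) → Fin N → Fin (D.nReg i)) (σ : Fin n → Fin N → Fin D.nLoss),
    (∀ j, ContinuousWithinAt (θ j) (D.feasible P) p₀) ∧
    ∀ᶠ p in 𝓝[D.feasible P] p₀,
      Monotone (fun j => θ j p) ∧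
      (∀ i, θ 0 p ≤ D.tStart i ∧ D.tLead i ≤ θ (Fin.last N) p) ∧
      ∀ (r : (i : Fin n) → ℝ → Fin (D.nReg i)) (x : Fin n → ℝ → VState d),
        D.Solves p r x →
        (r = D.activeRegime p x ∨ D.OnSchedule (fun j => θ j p) ρ r) →
        D.OnSchedule (fun j => θ j p) ρ (D.activeRegime p x) ∧
        D.OnSchedule (fun j => θ j p) (K := fun _ => D.nLoss) σ (D.activeLoss x)

end Platoon

end

noncomputable section

section IntegralEquations

/-- Grönwall's inequality in integral form. -/
lemma le_mul_exp_of_le_add_integral {φ : ℝ → ℝ} (hφ : Continuous φ) {a b C δ : ℝ} (hC : 0 ≤ C)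
    (h : ∀ t ∈ Icc a b, φ t ≤ δ + C * ∫ s in a..t, φ s) :
    ∀ t ∈ Icc a b, φ t ≤ δ * Real.exp (C * (t - a)) := by
  intro t ht
  set u : ℝ → ℝ := fun t => (δ + C * ∫ s in a..t, φ s) * Real.exp (-(C * (t - a))) with hu
  have hder : ∀ x, HasDerivAt u ((C * φ x) * Real.exp (-(C * (x - a))) +
      (δ + C * ∫ s in a..x, φ s) * (Real.exp (-(C * (x - a))) * (-(C * 1)))) x := by
    intro x
    have h1 : HasDerivAt (fun t => ∫ s in a..t, φ s) (φ x) x :=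
      intervalIntegral.integral_hasDerivAt_right (hφ.intervalIntegrable _ _)
        hφ.stronglyMeasurable.stronglyMeasurableAtFilter hφ.continuousAt
    have h2 : HasDerivAt (fun t => Real.exp (-(C * (t - a))))
        (Real.exp (-(C * (x - a))) * (-(C * 1))) x :=
      ((((hasDerivAt_id x).sub_const a).const_mul C).neg).exp
    exact ((h1.const_mul C).const_add δ).mul h2
  have hanti : AntitoneOn u (Icc a b) := by
    refine antitoneOn_of_deriv_nonpos (convex_Icc a b)
      (fun x _ => (hder x).continuousAt.continuousWithinAt)
      (fun x _ => (hder x).differentiableAt.differentiableWithinAt) ?_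
    intro x hx
    rw [interior_Icc] at hx
    rw [(hder x).deriv]
    have := h x (Ioo_subset_Icc_self hx)
    have he := Real.exp_pos (-(C * (x - a)))
    have : C * Real.exp (-(C * (x - a))) * (φ x - (δ + C * ∫ s in a..x, φ s)) ≤ 0 :=
      mul_nonpos_of_nonneg_of_nonpos (by positivity) (by linarith)
    linarith
  have h3 := hanti (left_mem_Icc.2 (ht.1.trans ht.2)) ht ht.1
  simp only [hu, intervalIntegral.integral_same, sub_self, mul_zero, neg_zero, Real.exp_zero,
    mul_one, add_zero] at h3
  rw [Real.exp_neg, ← div_eq_mul_inv, div_le_iff₀ (Real.exp_pos _)] at h3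
  exact (h t ht).trans h3

variable {E : Type*} [NormedAddCommGroup E]

/-- A function with finitely many discontinuities is measurable. -/
lemma aestronglyMeasurable_of_continuousAt_off_finite {f : ℝ → E} {Z : Set ℝ} (hZ : Z.Finite)
    (hf : ∀ t, t ∉ Z → ContinuousAt f t) : AEStronglyMeasurable f volume := by
  have h1 : ContinuousOn f Zᶜ := fun t ht => (hf t ht).continuousWithinAt
  have h2 := h1.aestronglyMeasurable (μ := volume) hZ.measurableSet.compl
  rwa [Measure.restrict_eq_self_of_ae_mem] at h2
  exact hZ.countable.ae_notMem volume

lemma integrable_indicator_Icc {f : ℝ → E} {c e : ℝ} (hce : c ≤ e) (hf : IntervalIntegrable f volume c e) :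
    Integrable (indicator (Icc c e) f) volume := by
  rwa [integrable_indicator_iff measurableSet_Icc, integrableOn_Icc_iff_integrableOn_Ioc,
    ← intervalIntegrable_iff_integrableOn_Ioc_of_le hce]

/-- A bounded function with finitely many discontinuities is integrable. -/
lemma intervalIntegrable_of_continuousAt_off_finite {f : ℝ → E} {c e B : ℝ} {Z : Set ℝ}
    (hZ : Z.Finite) (hce : c ≤ e) (hf : ∀ t ∈ Ioo c e, t ∉ Z → ContinuousAt f t)
    (hB : ∀ t ∈ Icc c e, ‖f t‖ ≤ B) : IntervalIntegrable f volume c e := by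
  have hm : AEStronglyMeasurable (indicator (Icc c e) f) volume := by
    refine aestronglyMeasurable_of_continuousAt_off_finite (hZ.union (toFinite {c, e}))
      fun t ht => ?_
    simp only [mem_union, mem_insert_iff, mem_singleton_iff, not_or] at ht
    by_cases htm : t ∈ Icc c e
    · have h' : t ∈ Ioo c e :=
        ⟨lt_of_le_of_ne htm.1 (Ne.symm ht.2.1), lt_of_le_of_ne htm.2 ht.2.2⟩
      refine (hf t h' ht.1).congr ?_
      filter_upwards [Ioo_mem_nhds h'.1 h'.2] with s hs
      rw [indicator_of_mem (Ioo_subset_Icc_self hs)]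
    · refine (continuousAt_const (y := (0 : E))).congr ?_
      filter_upwards [isClosed_Icc.isOpen_compl.mem_nhds htm] with s hs
      rw [indicator_of_notMem hs]
  have hi : IntervalIntegrable (indicator (Icc c e) f) volume c e := by
    refine (intervalIntegrable_const (c := B)).mono_fun hm.restrict ?_
    rw [EventuallyLE, ae_restrict_iff' measurableSet_uIoc]
    refine Eventually.of_forall fun t ht => ?_
    rw [uIoc_of_le hce] at ht
    rw [indicator_of_mem (Ioc_subset_Icc_self ht)]
    exact (hB t (Ioc_subset_Icc_self ht)).trans (le_abs_self B)
  refine hi.congr_uIoo fun t ht => ?_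
  rw [uIoo_of_le hce] at ht
  rw [indicator_of_mem (Ioo_subset_Icc_self ht)]

lemma indicator_Icc_neg {f : ℝ → E} {c e s : ℝ} :
    indicator (Icc c e) f (-s) = indicator (Icc (-e) (-c)) (fun s => f (-s)) s := by
  have h : -s ∈ Icc c e ↔ s ∈ Icc (-e) (-c) :=
    ⟨fun h => ⟨neg_le.1 h.2, le_neg.1 h.1⟩, fun h => ⟨le_neg.1 h.2, neg_le.1 h.1⟩⟩
  by_cases hs : s ∈ Icc (-e) (-c)
  · rw [indicator_of_mem hs, indicator_of_mem (h.2 hs)]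
  · rw [indicator_of_notMem hs, indicator_of_notMem (mt h.1 hs)]

/-- Right hand sides of Carathéodory type that are Lipschitz in the state with constant `C`. -/
structure LipField (C M : ℝ) (g : ℝ → E → E) : Prop where
  lip : ∀ s x y, ‖g s x - g s y‖ ≤ C * ‖x - y‖
  bdd : ∀ s, ‖g s 0‖ ≤ M
  meas : ∀ x : ℝ → E, Continuous x → AEStronglyMeasurable (fun s => g s (x s)) volume

variable {C M a b : ℝ} {g : ℝ → E → E} {x₀ : E}

lemma LipField.norm_le (hg : LipField C M g) (s : ℝ) (x : E) : ‖g s x‖ ≤ C * ‖x‖ + M := by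
  have h1 := hg.lip s x 0
  have h2 := hg.bdd s
  have h3 : ‖g s x‖ ≤ ‖g s x - g s 0‖ + ‖g s 0‖ := by
    simpa using norm_add_le (g s x - g s 0) (g s 0)
  rw [sub_zero] at h1
  linarith

lemma LipField.intervalIntegrable (hg : LipField C M g) {x : ℝ → E} (hx : Continuous x)
    (a b : ℝ) : IntervalIntegrable (fun s => g s (x s)) volume a b := by
  have h1 : IntervalIntegrable (fun s => C * ‖x s‖ + M) volume a b :=
    (by fun_prop : Continuous fun s => C * ‖x s‖ + M).intervalIntegrable a b
  refine h1.mono_fun (hg.meas x hx).restrict ?_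
  exact Eventually.of_forall fun s => (hg.norm_le s (x s)).trans (le_abs_self _)

variable [NormedSpace ℝ E]

/-- `x` solves `x' = g t x`, `x a = x₀` on `[a, b]` in integrated form. -/
structure IntegralSol (g : ℝ → E → E) (a b : ℝ) (x₀ : E) (x : ℝ → E) : Prop where
  cont : Continuous x
  eq : ∀ t ∈ Icc a b, x t = x₀ + ∫ s in a..t, g s (x s)

lemma IntegralSol.unique (hg : LipField C M g) (hC : 0 ≤ C) {x y : ℝ → E}
    (hx : IntegralSol g a b x₀ x) (hy : IntegralSol g a b x₀ y) :
    ∀ t ∈ Icc a b, x t = y t := by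
  intro t ht
  have hxc := hx.cont
  have hyc := hy.cont
  have key := le_mul_exp_of_le_add_integral (φ := fun t => ‖x t - y t‖) (by fun_prop)
    (a := a) (b := b) (C := C) (δ := 0) hC ?_ t ht
  · rw [zero_mul] at key
    exact sub_eq_zero.1 (norm_le_zero_iff.1 key)
  · intro t ht
    rw [hx.eq t ht, hy.eq t ht, add_sub_add_left_eq_sub,
      ← intervalIntegral.integral_sub (hg.intervalIntegrable hxc _ _)
        (hg.intervalIntegrable hyc _ _), zero_add, ← intervalIntegral.integral_const_mul]
    refine intervalIntegral.norm_integral_le_of_norm_le ht.1 ?_ ?_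
    · exact Eventually.of_forall fun s _ => hg.lip s _ _
    · exact (by fun_prop : Continuous fun s => C * ‖x s - y s‖).intervalIntegrable _ _

lemma LipField.exists_integralSol [CompleteSpace E] (hg : LipField C M g) (hC : 0 ≤ C)
    (hab : a ≤ b) (x₀ : E) : ∃ x, IntegralSol g a b x₀ x := by
  set c : ℝ := 2 * C + 1 with hc
  have hcpos : 0 < c := by positivity
  let ext : C(Icc a b, E) → ℝ → E := fun y s => Real.exp (c * s) • y (projIcc a b hab s)
  have hext : ∀ y, Continuous (ext y) := by
    intro y
    have := y.continuous.comp (continuous_projIcc (h := hab))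
    have h2 : Continuous fun s : ℝ => Real.exp (c * s) := by fun_prop
    exact h2.smul this
  have hint : ∀ y u v, IntervalIntegrable (fun s => g s (ext y s)) volume u v :=
    fun y u v => hg.intervalIntegrable (hext y) u v
  have hprim : ∀ y, Continuous fun t => ∫ s in a..t, g s (ext y s) := fun y =>
    intervalIntegral.continuous_primitive (fun u v => hint y u v) a
  let F : C(Icc a b, E) → C(Icc a b, E) := fun y =>
    ⟨fun t => Real.exp (-(c * t)) • (x₀ + ∫ s in a..(t : ℝ), g s (ext y s)), by
      have h1 := (hprim y).comp (continuous_subtype_val (p := fun t => t ∈ Icc a b))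
      have h2 : Continuous fun t : Icc a b => Real.exp (-(c * (t : ℝ))) := by fun_prop
      exact h2.smul (continuous_const.add h1)⟩
  have hF : ContractingWith (1 / 2) F := by
    refine ⟨by norm_num, LipschitzWith.of_dist_le_mul fun y z => ?_⟩
    rw [ContinuousMap.dist_le (by positivity)]
    intro t
    have ht := t.2
    have hb : ‖∫ s in a..(t : ℝ), (g s (ext y s) - g s (ext z s))‖ ≤
        ∫ s in a..(t : ℝ), C * dist y z * Real.exp (c * s) := by
      refine intervalIntegral.norm_integral_le_of_norm_le ht.1 ?_ ?_
      · refine Eventually.of_forall fun s _ => (hg.lip s _ _).trans ?_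
        have h1 : ext y s - ext z s =
            Real.exp (c * s) • (y (projIcc a b hab s) - z (projIcc a b hab s)) := by
          simp only [ext, smul_sub]
        rw [h1, norm_smul, Real.norm_eq_abs, abs_of_pos (Real.exp_pos _), ← dist_eq_norm]
        have h2 := ContinuousMap.dist_apply_le_dist (f := y) (g := z) (projIcc a b hab s)
        have h3 := mul_le_mul_of_nonneg_left h2 (mul_nonneg hC (Real.exp_pos (c * s)).le)
        linarith
      · exact (by fun_prop : Continuous fun s => C * dist y z * Real.exp (c * s)).intervalIntegrable
          _ _
    have hI : ∫ s in a..(t : ℝ), Real.exp (c * s) ≤ c⁻¹ * Real.exp (c * t) := by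
      rw [intervalIntegral.integral_comp_mul_left (fun s => Real.exp s) hcpos.ne', integral_exp,
        smul_eq_mul]
      have := Real.exp_pos (c * a)
      exact mul_le_mul_of_nonneg_left (by linarith) (by positivity)
    change dist (Real.exp (-(c * t)) • (x₀ + ∫ s in a..(t : ℝ), g s (ext y s)))
      (Real.exp (-(c * t)) • (x₀ + ∫ s in a..(t : ℝ), g s (ext z s))) ≤ _
    rw [dist_eq_norm, ← smul_sub, add_sub_add_left_eq_sub,
      ← intervalIntegral.integral_sub (hint _ _ _) (hint _ _ _), norm_smul, Real.norm_eq_abs,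
      abs_of_pos (Real.exp_pos _)]
    rw [intervalIntegral.integral_const_mul] at hb
    have hd : 0 ≤ dist y z := dist_nonneg
    have h4 : C * c⁻¹ ≤ 1 / 2 := by
      rw [← div_eq_mul_inv, div_le_iff₀ hcpos]; linarith
    calc Real.exp (-(c * t)) * ‖∫ s in a..(t : ℝ), (g s (ext y s) - g s (ext z s))‖
        ≤ Real.exp (-(c * t)) * (C * dist y z * (c⁻¹ * Real.exp (c * t))) := by
          refine mul_le_mul_of_nonneg_left (hb.trans ?_) (Real.exp_pos _).le
          exact mul_le_mul_of_nonneg_left hI (by positivity)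
      _ = C * c⁻¹ * dist y z * (Real.exp (-(c * t)) * Real.exp (c * t)) := by ring
      _ = C * c⁻¹ * dist y z := by rw [← Real.exp_add, neg_add_cancel, Real.exp_zero, mul_one]
      _ ≤ 1 / 2 * dist y z := mul_le_mul_of_nonneg_right h4 hd
      _ = _ := by simp
  let y := hF.fixedPoint
  have hy : F y = y := hF.fixedPoint_isFixedPt
  refine ⟨ext y, hext y, fun t ht => ?_⟩
  have h1 : y ⟨t, ht⟩ = Real.exp (-(c * t)) • (x₀ + ∫ s in a..t, g s (ext y s)) := by
    conv_lhs => rw [← hy]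
    rfl
  change Real.exp (c * t) • y (projIcc a b hab t) = _
  rw [projIcc_of_mem hab ht, h1, smul_smul, ← Real.exp_add, add_neg_cancel, Real.exp_zero, one_smul]

/-- Solutions depend continuously on a parameter if the right hand sides converge pointwise along
the limit solution. -/
lemma IntegralSol.eventually_close {ι : Type*} {l : Filter ι} [l.IsCountablyGenerated]
    {g : ι → ℝ → E → E} {g₀ : ℝ → E → E} {x : ℝ → E} (hC : 0 ≤ C) (hab : a ≤ b)
    (hg : ∀ᶠ p in l, LipField C M (g p)) (hg₀ : LipField C M g₀)
    (hx : IntegralSol g₀ a b x₀ x)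
    (hlim : ∀ᵐ s, Tendsto (fun p => g p s (x s)) l (𝓝 (g₀ s (x s)))) {ε : ℝ} (hε : 0 < ε) :
    ∀ᶠ p in l, ∀ y, IntegralSol (g p) a b x₀ y → ∀ t ∈ Icc a b, ‖y t - x t‖ ≤ ε := by
  have hxc := hx.cont
  have hδ : Tendsto (fun p => ∫ s in a..b, ‖g p s (x s) - g₀ s (x s)‖) l
      (𝓝 (∫ s in a..b, (0 : ℝ))) := by
    refine intervalIntegral.tendsto_integral_filter_of_dominated_convergence
      (fun s => (C * ‖x s‖ + M) + (C * ‖x s‖ + M)) ?_ ?_ ?_ ?_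
    · filter_upwards [hg] with p hp
      exact ((hp.meas x hxc).sub (hg₀.meas x hxc)).norm.restrict
    · filter_upwards [hg] with p hp
      refine Eventually.of_forall fun s _ => ?_
      rw [norm_norm]
      exact (norm_sub_le _ _).trans (add_le_add (hp.norm_le _ _) (hg₀.norm_le _ _))
    · exact (by fun_prop : Continuous fun s =>
        (C * ‖x s‖ + M) + (C * ‖x s‖ + M)).intervalIntegrable _ _
    · filter_upwards [hlim] with s hs _
      have := (hs.sub_const (g₀ s (x s))).norm
      simpa using this
  rw [intervalIntegral.integral_zero] at hδ
  have hsmall : 0 < ε / Real.exp (C * (b - a)) := by positivity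
  filter_upwards [hg, hδ.eventually (gt_mem_nhds hsmall)] with p hp hpδ y hy t ht
  have hyc := hy.cont
  set δ := ∫ s in a..b, ‖g p s (x s) - g₀ s (x s)‖ with hδdef
  have hdint : ∀ u v, IntervalIntegrable (fun s => ‖g p s (x s) - g₀ s (x s)‖) volume u v :=
    fun u v => ((hp.intervalIntegrable hxc u v).sub (hg₀.intervalIntegrable hxc u v)).norm
  have key := le_mul_exp_of_le_add_integral (φ := fun t => ‖y t - x t‖) (by fun_prop)
    (a := a) (b := b) (C := C) (δ := δ) hC ?_ t ht
  · refine key.trans ?_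
    have h1 : Real.exp (C * (t - a)) ≤ Real.exp (C * (b - a)) :=
      Real.exp_le_exp.2 (mul_le_mul_of_nonneg_left (by linarith [ht.2]) hC)
    have hδ0 : 0 ≤ δ := intervalIntegral.integral_nonneg hab fun s _ => norm_nonneg _
    have h2 := (lt_div_iff₀ (Real.exp_pos _)).1 hpδ
    exact (mul_le_mul_of_nonneg_left h1 hδ0).trans h2.le
  · intro t ht
    have hcint : IntervalIntegrable (fun s => C * ‖y s - x s‖) volume a t :=
      (by fun_prop : Continuous fun s => C * ‖y s - x s‖).intervalIntegrable _ _
    have hle : ∫ s in a..t, ‖g p s (x s) - g₀ s (x s)‖ ≤ δ := by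
      refine intervalIntegral.integral_mono_interval le_rfl ht.1 ht.2 ?_ (hdint a b)
      exact Eventually.of_forall fun s => norm_nonneg _
    calc ‖y t - x t‖ = ‖∫ s in a..t, (g p s (y s) - g₀ s (x s))‖ := by
          rw [hx.eq t ht, hy.eq t ht, add_sub_add_left_eq_sub,
            ← intervalIntegral.integral_sub (hp.intervalIntegrable hyc _ _)
              (hg₀.intervalIntegrable hxc _ _)]
      _ ≤ ∫ s in a..t, (‖g p s (x s) - g₀ s (x s)‖ + C * ‖y s - x s‖) := by
          refine intervalIntegral.norm_integral_le_of_norm_le ht.1 ?_ ((hdint a t).add hcint)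
          refine Eventually.of_forall fun s _ => ?_
          have h1 := norm_add_le (g p s (x s) - g₀ s (x s)) (g p s (y s) - g p s (x s))
          have h2 := hp.lip s (y s) (x s)
          have h3 : g p s (x s) - g₀ s (x s) + (g p s (y s) - g p s (x s)) =
            g p s (y s) - g₀ s (x s) := by abel
          rw [h3] at h1
          linarith
      _ = (∫ s in a..t, ‖g p s (x s) - g₀ s (x s)‖) + C * ∫ s in a..t, ‖y s - x s‖ := by
          rw [intervalIntegral.integral_add (hdint a t) hcint,
            intervalIntegral.integral_const_mul]
      _ ≤ _ := by gcongr

section Indicator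

variable {f : ℝ → E} {c e t : ℝ}

lemma integral_indicator_Icc (hac : a ≤ c) (hce : c ≤ e) (hct : c ≤ t) :
    ∫ s in a..t, indicator (Icc c e) f s = ∫ s in c..(min t e), f s := by
  rw [intervalIntegral.integral_of_le (hac.trans hct), setIntegral_indicator measurableSet_Icc,
    intervalIntegral.integral_of_le (le_min hct hce)]
  refine setIntegral_congr_set ?_
  have h : ∀ᵐ s : ℝ, s ≠ c := by simp [ae_iff]
  filter_upwards [h] with s hs
  refine propext ⟨fun h => ?_, fun h => ?_⟩
  · exact ⟨lt_of_le_of_ne h.2.1 (Ne.symm hs), le_min h.1.2 h.2.2⟩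
  · exact ⟨⟨hac.trans_lt h.1, h.2.trans (min_le_left _ _)⟩, h.1.le, h.2.trans (min_le_right _ _)⟩

end Indicator

end IntegralEquations

/-- To reach `b` from `a` it suffices to be able to cross intervals free of breakpoints. -/
lemma induction_on_breakpoints {Z : Set ℝ} (hZ : Z.Finite) {a : ℝ} {Q : ℝ → Prop} (h0 : Q a)
    (hstep : ∀ u v, a ≤ u → u < v → Disjoint (Ioo u v) Z → Q u → Q v) {b : ℝ} (hb : a ≤ b) :
    Q b := by
  obtain ⟨m, hm⟩ : ∃ m, (Z ∩ Ioo a b).ncard = m := ⟨_, rfl⟩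
  induction m using Nat.strong_induction_on generalizing b with
  | _ m ih =>
    rcases hb.eq_or_lt with rfl | hlt
    · exact h0
    have hfin : (Z ∩ Ioo a b).Finite := hZ.subset inter_subset_left
    rcases (Z ∩ Ioo a b).eq_empty_or_nonempty with he | hne
    · refine hstep a b le_rfl hlt ?_ h0
      rw [Set.disjoint_iff_inter_eq_empty, inter_comm]
      exact he
    · obtain ⟨c, hc, hmax⟩ := hfin.exists_maximalFor id _ hne
      have hlt' : (Z ∩ Ioo a c).ncard < m := by
        rw [← hm]
        refine Set.ncard_lt_ncard ⟨fun z hz => ⟨hz.1, hz.2.1, hz.2.2.trans hc.2.2⟩, ?_⟩ hfin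
        intro hsub
        exact lt_irrefl c (hsub hc).2.2
      refine hstep c b hc.2.1.le hc.2.2 ?_ (ih _ hlt' hc.2.1.le rfl)
      rw [Set.disjoint_left]
      intro z hz hzZ
      have := hmax ⟨hzZ, hc.2.1.trans hz.1, hz.2⟩ hz.1.le
      exact absurd hz.1 (not_lt.2 this)

/-- A function with finite one-sided limits at each point of a compact interval is bounded. -/
lemma PiecewiseContOn.bounded {E : Type*} [NormedAddCommGroup E] {φ : ℝ → E} {a b : ℝ}
    (h : PiecewiseContOn φ a b) : ∃ B, ∀ t ∈ Icc a b, ‖φ t‖ ≤ B := by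
  refine isCompact_Icc.induction_on (p := fun s => ∃ B, ∀ t ∈ s, ‖φ t‖ ≤ B) ⟨0, by simp⟩
    (fun s t hst ⟨B, hB⟩ => ⟨B, fun x hx => hB x (hst hx)⟩) ?_ ?_
  · rintro s t ⟨B, hB⟩ ⟨B', hB'⟩
    refine ⟨max B B', fun x hx => ?_⟩
    rcases hx with hx | hx
    · exact (hB x hx).trans (le_max_left _ _)
    · exact (hB' x hx).trans (le_max_right _ _)
  · intro t ht
    obtain ⟨⟨l₁, h₁⟩, ⟨l₂, h₂⟩⟩ := h.2 t ht
    have e₁ := h₁.norm.eventually (gt_mem_nhds (lt_add_one ‖l₁‖))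
    have e₂ := h₂.norm.eventually (gt_mem_nhds (lt_add_one ‖l₂‖))
    rw [eventually_nhdsWithin_iff] at e₁ e₂
    refine ⟨{s | ‖φ s‖ ≤ max ‖φ t‖ (max (‖l₁‖ + 1) (‖l₂‖ + 1))}, ?_, _, fun s hs => hs⟩
    rw [mem_nhdsWithin_iff_eventually]
    filter_upwards [e₁, e₂] with s hs₁ hs₂ hs
    rcases lt_trichotomy s t with hst | rfl | hst
    · exact (hs₁ ⟨hs, hst⟩).le.trans ((le_max_left _ _).trans (le_max_right _ _))
    · exact le_max_left _ _
    · exact (hs₂ ⟨hs, hst⟩).le.trans ((le_max_right _ _).trans (le_max_right _ _))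

/-- A jointly continuous function is bounded on a compact set, locally uniformly in a parameter. -/
lemma eventually_bound_of_continuousOn {X Y F : Type*} [TopologicalSpace X] [TopologicalSpace Y]
    [NormedAddCommGroup F] {f : X × Y → F} {K : Set X} (hK : IsCompact K) {P : Set Y}
    (hf : ContinuousOn f (univ ×ˢ P)) {q : Y} (hq : q ∈ P) :
    ∃ B, ∀ᶠ q' in 𝓝[P] q, ∀ x ∈ K, ‖f (x, q')‖ ≤ B := by
  refine hK.induction_on (p := fun s => ∃ B, ∀ᶠ q' in 𝓝[P] q, ∀ x ∈ s, ‖f (x, q')‖ ≤ B)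
    ⟨0, by simp⟩ (fun s t hst ⟨B, hB⟩ => ⟨B, hB.mono fun q' h x hx => h x (hst hx)⟩) ?_ ?_
  · rintro s t ⟨B, hB⟩ ⟨B', hB'⟩
    refine ⟨max B B', ?_⟩
    filter_upwards [hB, hB'] with q' h h' x hx
    rcases hx with hx | hx
    · exact (h x hx).trans (le_max_left _ _)
    · exact (h' x hx).trans (le_max_right _ _)
  · intro x _
    have h1 := (hf (x, q) ⟨mem_univ _, hq⟩).norm.eventually
      (gt_mem_nhds (lt_add_one ‖f (x, q)‖))
    rw [nhdsWithin_prod_eq, nhdsWithin_univ] at h1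
    obtain ⟨pa, ha, pb, hb, hab⟩ := Filter.eventually_prod_iff.1 h1
    refine ⟨{x | pa x}, mem_nhdsWithin_of_mem_nhds ha, ‖f (x, q)‖ + 1, ?_⟩
    filter_upwards [hb] with q' hq' x' hx'
    exact (hab hx' hq').le

/-- Coordinatewise truncation to `[-R, R]`. -/
def clampState {d : ℕ} (R : ℝ) (x : VState d) : VState d :=
  WithLp.toLp 2 fun k => max (-R) (min R (x k))

lemma norm_clampState_sub_le {d : ℕ} (R : ℝ) (x y : VState d) :
    ‖clampState R x - clampState R y‖ ≤ ‖x - y‖ := by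
  rw [EuclideanSpace.norm_eq, EuclideanSpace.norm_eq]
  refine Real.sqrt_le_sqrt (Finset.sum_le_sum fun k _ => ?_)
  refine pow_le_pow_left₀ (norm_nonneg _) ?_ 2
  simp only [clampState, PiLp.sub_apply, Real.norm_eq_abs]
  refine (abs_max_sub_max_le_max _ _ _ _).trans ?_
  rw [sub_self, abs_zero]
  refine max_le (abs_nonneg _) ((abs_min_sub_min_le_max _ _ _ _).trans ?_)
  rw [sub_self, abs_zero]
  exact max_le (abs_nonneg _) le_rfl

lemma clampState_eq_self {d : ℕ} {R : ℝ} {x : VState d} (hx : ‖x‖ ≤ R) : clampState R x = x := by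
  ext k
  have h1 := (PiLp.norm_apply_le x k).trans hx
  rw [Real.norm_eq_abs, abs_le] at h1
  simp [clampState, h1.1, h1.2]

lemma norm_clampState_le {d : ℕ} {R : ℝ} (hR : 0 ≤ R) (x : VState d) : ‖clampState R x‖ ≤ ‖x‖ := by
  have h := norm_clampState_sub_le R x 0
  rwa [clampState_eq_self (x := 0) (by simpa using hR), sub_zero, sub_zero] at h

lemma continuous_clampState {d : ℕ} (R : ℝ) : Continuous (clampState (d := d) R) :=
  (LipschitzWith.of_dist_le_mul (K := 1) fun x y => by
    simpa [dist_eq_norm] using norm_clampState_sub_le R x y).continuous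

lemma exists_norm_clampState_le (d : ℕ) (R : ℝ) : ∃ B, ∀ x : VState d, ‖clampState R x‖ ≤ B := by
  refine ⟨√(∑ _ : Fin d, |R| ^ 2), fun x => ?_⟩
  rw [EuclideanSpace.norm_eq]
  refine Real.sqrt_le_sqrt (Finset.sum_le_sum fun k _ => ?_)
  refine pow_le_pow_left₀ (norm_nonneg _) ?_ 2
  simp only [clampState, Real.norm_eq_abs, abs_le]
  constructor
  · exact le_max_of_le_left (neg_le_neg (le_abs_self R))
  · exact max_le (neg_le_abs R) ((min_le_left _ _).trans (le_abs_self R))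

lemma exists_mem_Ioo_of_lt_of_lt {N : ℕ} {θ : Fin (N + 1) → ℝ} {t : ℝ} (h0 : θ 0 < t)
    (hN : t < θ (Fin.last N)) (hne : ∀ j, t ≠ θ j) :
    ∃ j : Fin N, t ∈ Ioo (θ j.castSucc) (θ j.succ) := by
  by_contra! hcon
  have h : ∀ j, θ j < t := by
    intro j
    induction j using Fin.induction with
    | zero => exact h0
    | succ j ih =>
      refine lt_of_le_of_ne (not_lt.1 fun h => hcon j ⟨ih, h⟩) (hne _).symm
  exact lt_asymm hN (h _)

lemma exists_common_bound {α ι : Type*} [Finite α] {l : Filter ι} {Q : α → ι → ℝ → Prop}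
    (hmono : ∀ a p B B', B ≤ B' → Q a p B → Q a p B')
    (h : ∀ a, ∃ B, ∀ᶠ p in l, Q a p B) : ∃ B, 0 ≤ B ∧ ∀ᶠ p in l, ∀ a, Q a p B := by
  choose B hB using h
  obtain ⟨M, hM⟩ := (Set.finite_range B).bddAbove
  refine ⟨max M 0, le_max_right _ _, eventually_all.2 fun a => (hB a).mono fun p hp => ?_⟩
  exact hmono a p _ _ ((hM (mem_range_self a)).trans (le_max_left _ _)) hp

namespace Platoon

variable {n d : ℕ} {D : Platoon n d} {P : (i : Fin n) → Set (D.Par i)}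

/-- Times at which no vehicle enters, leaves, changes its leader or sees its external leader
jump. -/
def GenericTime (D : Platoon n d) (t : ℝ) : Prop :=
  ∀ i, t ≠ D.tStart i ∧ t ≠ D.tLead i ∧ t ≠ D.tEnd i ∧
    (t ∈ Icc (D.tStart i) (D.tLead i) →
      (∀ᶠ τ in 𝓝 t, D.leader i τ = D.leader i t) ∧ ContinuousAt (D.extLead i) t)

lemma Admissible.finite_not_genericTime (hD : D.Admissible) : {t | ¬ D.GenericTime t}.Finite := by
  choose s hs hs' using hD.leader_changes
  choose s₂ hs₂ hs₂' using fun i => (hD.ext_cont i).1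
  refine (Set.finite_iUnion fun i => (((Set.toFinite {D.tStart i, D.tLead i, D.tEnd i}).union
    (hs i)).union (hs₂ i))).subset fun t ht => ?_
  by_contra hcon
  refine ht fun i => ?_
  have hi : t ∉ _ := fun h => hcon (mem_iUnion.2 ⟨i, h⟩)
  simp only [mem_union, mem_insert_iff, mem_singleton_iff, not_or] at hi
  refine ⟨hi.1.1.1, hi.1.1.2.1, hi.1.1.2.2, fun hmem => ?_⟩
  have hn : Icc (D.tStart i) (D.tLead i) ∈ 𝓝 t :=
    Icc_mem_nhds (lt_of_le_of_ne hmem.1 (Ne.symm hi.1.1.1)) (lt_of_le_of_ne hmem.2 hi.1.1.2.1)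
  refine ⟨?_, ?_⟩
  · have := hs' i t hmem hi.1.2
    rwa [nhdsWithin_eq_nhds.2 hn] at this
  · exact (hs₂' i t hmem hi.2).continuousAt hn

lemma GenericTime.mem_Ioo_lead {t : ℝ} (ht : D.GenericTime t) {i : Fin n}
    (hi : t ∈ Icc (D.tStart i) (D.tLead i)) : t ∈ Ioo (D.tStart i) (D.tLead i) :=
  ⟨lt_of_le_of_ne hi.1 (Ne.symm (ht i).1), lt_of_le_of_ne hi.2 (ht i).2.1⟩

lemma GenericTime.mem_Ioo_end {t : ℝ} (ht : D.GenericTime t) {i : Fin n}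
    (hi : t ∈ Icc (D.tStart i) (D.tEnd i)) : t ∈ Ioo (D.tStart i) (D.tEnd i) :=
  ⟨lt_of_le_of_ne hi.1 (Ne.symm (ht i).1), lt_of_le_of_ne hi.2 (ht i).2.2.1⟩

lemma Admissible.continuousAt_data (hD : D.Admissible) {t : ℝ} (ht : D.GenericTime t) {i : Fin n}
    (hi : t ∈ Icc (D.tStart i) (D.tEnd i)) : ContinuousAt (D.data i) t :=
  (hD.data_cont i t hi).continuousAt
    (Icc_mem_nhds (ht.mem_Ioo_end hi).1 (ht.mem_Ioo_end hi).2)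

lemma Admissible.mem_Icc_end (hD : D.Admissible) {t : ℝ} {i : Fin n}
    (hi : t ∈ Icc (D.tStart i) (D.tLead i)) : t ∈ Icc (D.tStart i) (D.tEnd i) :=
  ⟨hi.1, hi.2.trans (hD.lead_le_end i)⟩

lemma tendsto_lead {ι : Type*} {l : Filter ι} {τ : ι → ℝ} {t₀ : ℝ}
    {X : ι → Fin n → ℝ → VState d} {x₀ : Fin n → ℝ → VState d} (hD : D.Admissible)
    (ht : D.GenericTime t₀) (hτ : Tendsto τ l (𝓝 t₀))
    (hX : ∀ k, t₀ ∈ Icc (D.tStart k) (D.tEnd k) →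
      Tendsto (fun a => X a k (τ a)) l (𝓝 (x₀ k t₀)))
    {i : Fin n} (hi : t₀ ∈ Icc (D.tStart i) (D.tLead i)) :
    Tendsto (fun a => D.lead (X a) i (τ a)) l (𝓝 (D.lead x₀ i t₀)) := by
  obtain ⟨h1, h2⟩ := (ht i).2.2.2 hi
  have h1' := hτ.eventually h1
  cases hl : D.leader i t₀ with
  | none =>
    have : Tendsto (fun a => D.extLead i (τ a)) l (𝓝 (D.lead x₀ i t₀)) := by
      simp only [lead, hl, Option.elim]
      exact h2.tendsto.comp hτ
    refine this.congr' ?_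
    filter_upwards [h1'] with a ha
    simp [lead, ha, hl]
  | some k =>
    have : Tendsto (fun a => X a k (τ a)) l (𝓝 (D.lead x₀ i t₀)) := by
      simp only [lead, hl, Option.elim]
      exact hX k (hD.leader_present i k t₀ ⟨hl, hi⟩)
    refine this.congr' ?_
    filter_upwards [h1'] with a ha
    simp [lead, ha, hl]

lemma leader_eq_of_forall_genericTime {u v : ℝ} (hgen : ∀ t ∈ Ioo u v, D.GenericTime t)
    {i : Fin n} (hi : Ioo u v ⊆ Icc (D.tStart i) (D.tLead i)) {s t : ℝ} (hs : s ∈ Ioo u v)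
    (ht : t ∈ Ioo u v) : D.leader i s = D.leader i t := by
  refine isPreconnected_Ioo.induction₂ (fun s t => D.leader i s = D.leader i t) ?_
    (fun _ _ _ _ _ _ h h' => h.trans h') (fun _ _ _ _ h => h.symm) hs ht
  intro x hx
  exact nhdsWithin_le_nhds (((hgen x hx i).2.2.2 (hi hx)).1.mono fun y hy => hy.symm)

/-- `[a, b]` contains all times at which a vehicle is present. -/
def Covers (D : Platoon n d) (a b : ℝ) : Prop := ∀ i, a ≤ D.tStart i ∧ D.tEnd i ≤ b

lemma exists_covers (D : Platoon n d) : ∃ T, 0 ≤ T ∧ D.Covers (-T) T := by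
  obtain ⟨M, hM⟩ := (Set.finite_range fun i => |D.tStart i| + |D.tEnd i|).bddAbove
  refine ⟨|M|, abs_nonneg M, fun i => ?_⟩
  have h : |D.tStart i| + |D.tEnd i| ≤ |M| := (hM (mem_range_self i)).trans (le_abs_self M)
  have h1 := neg_abs_le (D.tStart i)
  have h2 := le_abs_self (D.tEnd i)
  constructor <;> linarith [abs_nonneg (D.tStart i), abs_nonneg (D.tEnd i)]

section Schedule

variable {N : ℕ} {K : Fin n → ℕ} {ρ : (i : Fin n) → Fin N → Fin (K i)}

lemma OnSchedule.eventually_eq {ι : Type*} {l : Filter ι} {θ₀ : Fin (N + 1) → ℝ}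
    {θ : ι → Fin (N + 1) → ℝ} {r₀ : (i : Fin n) → ℝ → Fin (K i)}
    {r : ι → (i : Fin n) → ℝ → Fin (K i)} {τ : ι → ℝ} {t₀ : ℝ} {i : Fin n}
    (hr₀ : D.OnSchedule θ₀ ρ r₀) (hr : ∀ᶠ a in l, D.OnSchedule (θ a) ρ (r a))
    (hle : θ₀ 0 ≤ D.tStart i ∧ D.tLead i ≤ θ₀ (Fin.last N))
    (hθ : ∀ j, Tendsto (fun a => θ a j) l (𝓝 (θ₀ j))) (hτ : Tendsto τ l (𝓝 t₀))
    (ht : t₀ ∈ Ioo (D.tStart i) (D.tLead i)) (hne : ∀ j, t₀ ≠ θ₀ j) :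
    ∀ᶠ a in l, r a i (τ a) = r₀ i t₀ := by
  obtain ⟨j, hj⟩ := exists_mem_Ioo_of_lt_of_lt (hle.1.trans_lt ht.1) (ht.2.trans_le hle.2) hne
  rw [hr₀ i j t₀ hj (Ioo_subset_Icc_self ht)]
  filter_upwards [hr, (hθ j.castSucc).eventually_lt hτ hj.1, hτ.eventually_lt (hθ j.succ) hj.2,
    hτ.eventually (Ioo_mem_nhds ht.1 ht.2)] with a h1 h2 h3 h4
  exact h1 i j _ ⟨h2, h3⟩ (Ioo_subset_Icc_self h4)

open Classical in
/-- The regime signal of a schedule. -/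
def scheduleSignal (θ : Fin (N + 1) → ℝ) (ρ : (i : Fin n) → Fin N → Fin (K i))
    (r₀ : (i : Fin n) → Fin (K i)) (i : Fin n) (t : ℝ) : Fin (K i) :=
  if h : ∃ j : Fin N, t ∈ Ioo (θ j.castSucc) (θ j.succ) then ρ i h.choose else r₀ i

lemma onSchedule_scheduleSignal {θ : Fin (N + 1) → ℝ} (hθ : Monotone θ)
    (r₀ : (i : Fin n) → Fin (K i)) : D.OnSchedule θ ρ (scheduleSignal θ ρ r₀) := by
  intro i j t ht _
  have h : ∃ j : Fin N, t ∈ Ioo (θ j.castSucc) (θ j.succ) := ⟨j, ht⟩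
  rw [scheduleSignal, dif_pos h]
  have hlt : ∀ j j' : Fin N, t ∈ Ioo (θ j.castSucc) (θ j.succ) →
      t ∈ Ioo (θ j'.castSucc) (θ j'.succ) → j ≤ j' := by
    intro j j' hj hj'
    by_contra hcon
    have h1 : θ j'.succ ≤ θ j.castSucc := hθ (by
      rw [Fin.le_def]; simpa using not_le.1 hcon)
    exact absurd (hj'.2.trans_le h1) (not_lt.2 hj.1.le)
  rw [le_antisymm (hlt _ _ h.choose_spec ht) (hlt _ _ ht h.choose_spec)]

/-- Regime signals that switch finitely often. -/
def FinitelySwitching (D : Platoon n d) (r : (i : Fin n) → ℝ → Fin (K i)) : Prop :=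
  ∃ Z : Set ℝ, Z.Finite ∧ ∀ i, ∀ t ∈ Ioo (D.tStart i) (D.tLead i), t ∉ Z →
    ∀ᶠ τ in 𝓝 t, r i τ = r i t

lemma OnSchedule.finitelySwitching {θ : Fin (N + 1) → ℝ} {r : (i : Fin n) → ℝ → Fin (K i)}
    (hr : D.OnSchedule θ ρ r) (hle : ∀ i, θ 0 ≤ D.tStart i ∧ D.tLead i ≤ θ (Fin.last N)) :
    D.FinitelySwitching r :=
  ⟨range θ, finite_range θ, fun i _ ht hne => hr.eventually_eq (.of_forall fun _ => hr) (hle i)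
    (fun _ => tendsto_const_nhds) tendsto_id ht fun j h => hne ⟨j, h.symm⟩⟩

lemma OnSchedule.eq_of_not_mem_range {θ : Fin (N + 1) → ℝ} {r r' : (i : Fin n) → ℝ → Fin (K i)}
    (hr : D.OnSchedule θ ρ r) (hr' : D.OnSchedule θ ρ r') {i : Fin n}
    (hle : θ 0 ≤ D.tStart i ∧ D.tLead i ≤ θ (Fin.last N)) {t : ℝ}
    (ht : t ∈ Ioc (D.tStart i) (D.tLead i)) (hne : t ∉ range θ) : r i t = r' i t := by
  have hne' : ∀ j, t ≠ θ j := fun j h => hne ⟨j, h.symm⟩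
  obtain ⟨j, hj⟩ := exists_mem_Ioo_of_lt_of_lt (hle.1.trans_lt ht.1)
    (lt_of_le_of_ne (ht.2.trans hle.2) (hne' _)) hne'
  rw [hr i j t hj (Ioc_subset_Icc_self ht), hr' i j t hj (Ioc_subset_Icc_self ht)]

lemma Solves.of_onSchedule [NeZero d] (hD : D.Admissible) {p : D.Params} {θ : Fin (N + 1) → ℝ}
    {ρ : (i : Fin n) → Fin N → Fin (D.nReg i)}
    {r r' : (i : Fin n) → ℝ → Fin (D.nReg i)} {x : Fin n → ℝ → VState d} (hx : D.Solves p r x)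
    (hr : D.OnSchedule θ ρ r) (hr' : D.OnSchedule θ ρ r')
    (hle : ∀ i, θ 0 ≤ D.tStart i ∧ D.tLead i ≤ θ (Fin.last N)) : D.Solves p r' x := by
  intro i
  have hae : ∀ᵐ s : ℝ, s ∉ range θ := (finite_range θ).countable.ae_notMem _
  have heq : ∀ t ∈ Icc (D.tStart i) (D.tLead i), ∀ᵐ s : ℝ, s ∈ uIoc (D.tStart i) t →
      D.model i (r i s) (x i s) (D.lead x i s) (p i) =
      D.model i (r' i s) (x i s) (D.lead x i s) (p i) := by
    intro t ht
    filter_upwards [hae] with s hs hmem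
    rw [uIoc_of_le ht.1] at hmem
    rw [hr.eq_of_not_mem_range hr' (hle i) ⟨hmem.1, hmem.2.trans ht.2⟩ hs]
  obtain ⟨h1, h2, h3⟩ := hx i
  refine ⟨h1.congr_ae ?_, fun t ht => ?_, h3⟩
  · rw [EventuallyEq, ae_restrict_iff' measurableSet_uIoc]
    exact heq _ (right_mem_Icc.2 (hD.start_le_lead i))
  · rw [h2 t ht, intervalIntegral.integral_congr_ae (heq t ht)]

end Schedule

section ModelBounds

lemma tendsto_apply_nhdsWithin {p₀ : D.Params} (i : Fin n) :
    Tendsto (fun p : D.Params => p i) (𝓝[D.feasible P] p₀) (𝓝[P i] (p₀ i)) := by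
  refine tendsto_nhdsWithin_iff.2 ⟨(continuous_apply i).continuousAt.mono_left
    nhdsWithin_le_nhds, ?_⟩
  filter_upwards [self_mem_nhdsWithin] with p hp
  exact hp i (mem_univ i)

/-- Joint continuity of a regime in the states and the parameters gives bounds on balls, locally
uniformly in the parameters. -/
lemma eventually_bound_on_balls {F : Type*} [NormedAddCommGroup F] {i : Fin n}
    {f : VState d × VState d × D.Par i → F} (hf : ContinuousOn f (univ ×ˢ univ ×ˢ P i))
    {p₀ : D.Params} (hp₀ : p₀ ∈ D.feasible P) (R : ℝ) :
    ∃ B, ∀ᶠ p in 𝓝[D.feasible P] p₀, ∀ x y, ‖x‖ ≤ R → ‖y‖ ≤ R → ‖f (x, y, p i)‖ ≤ B := by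
  have hK : IsCompact (Metric.closedBall (0 : VState d) R ×ˢ Metric.closedBall (0 : VState d) R) :=
    (isCompact_closedBall _ _).prod (isCompact_closedBall _ _)
  have hf' : ContinuousOn (fun w : (VState d × VState d) × D.Par i => f (w.1.1, w.1.2, w.2))
      (univ ×ˢ P i) :=
    hf.comp (by fun_prop) fun w hw => ⟨mem_univ _, mem_univ _, hw.2⟩
  obtain ⟨B, hB⟩ := eventually_bound_of_continuousOn hK hf' (hp₀ i (mem_univ i))
  refine ⟨B, ((tendsto_apply_nhdsWithin i).eventually hB).mono fun p hp x y hx hy => ?_⟩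
  exact hp (x, y) ⟨by simpa using hx, by simpa using hy⟩

lemma ModelRegular.eventually_bounds (hm : D.ModelRegular P) {p₀ : D.Params}
    (hp₀ : p₀ ∈ D.feasible P) (R : ℝ) :
    ∃ B, 0 ≤ B ∧ ∀ᶠ p in 𝓝[D.feasible P] p₀, ∀ i r x y, ‖x‖ ≤ R → ‖y‖ ≤ R →
      ‖D.model i r x y (p i)‖ ≤ B ∧
      ‖fderiv ℝ (fun x' => D.model i r x' y (p i)) x‖ ≤ B ∧
      ‖fderiv ℝ (fun y' => D.model i r x y' (p i)) y‖ ≤ B ∧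
      ‖fderiv ℝ (fun q' => D.model i r x y q') (p i)‖ ≤ B := by
  have h := exists_common_bound (α := Σ i, Fin (D.nReg i)) (l := 𝓝[D.feasible P] p₀)
    (Q := fun a p B => ∀ x y, ‖x‖ ≤ R → ‖y‖ ≤ R →
      ‖D.model a.1 a.2 x y (p a.1)‖ ≤ B ∧
      ‖fderiv ℝ (fun x' => D.model a.1 a.2 x' y (p a.1)) x‖ ≤ B ∧
      ‖fderiv ℝ (fun y' => D.model a.1 a.2 x y' (p a.1)) y‖ ≤ B ∧
      ‖fderiv ℝ (fun q' => D.model a.1 a.2 x y q') (p a.1)‖ ≤ B) ?_ ?_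
  · obtain ⟨B, h0, hB⟩ := h
    exact ⟨B, h0, hB.mono fun p hp i r => hp ⟨i, r⟩⟩
  · intro a p B B' hBB' h x y hx hy
    obtain ⟨h1, h2, h3, h4⟩ := h x y hx hy
    exact ⟨h1.trans hBB', h2.trans hBB', h3.trans hBB', h4.trans hBB'⟩
  · rintro ⟨i, r⟩
    obtain ⟨B₁, h₁⟩ := eventually_bound_on_balls (hm.cont i r) hp₀ R
    obtain ⟨B₂, h₂⟩ := eventually_bound_on_balls (hm.cont_dx i r) hp₀ R
    obtain ⟨B₃, h₃⟩ := eventually_bound_on_balls (hm.cont_dlead i r) hp₀ R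
    obtain ⟨B₄, h₄⟩ := eventually_bound_on_balls (hm.cont_dpar i r) hp₀ R
    refine ⟨max (max B₁ B₂) (max B₃ B₄), ?_⟩
    filter_upwards [h₁, h₂, h₃, h₄] with p h₁ h₂ h₃ h₄ x y hx hy
    exact ⟨(h₁ x y hx hy).trans (le_max_of_le_left (le_max_left _ _)),
      (h₂ x y hx hy).trans (le_max_of_le_left (le_max_right _ _)),
      (h₃ x y hx hy).trans (le_max_of_le_right (le_max_left _ _)),
      (h₄ x y hx hy).trans (le_max_of_le_right (le_max_right _ _))⟩

lemma tendsto_regime {i : Fin n} {F ι : Type*} [TopologicalSpace F] {l : Filter ι}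
    {f : VState d × VState d × D.Par i → F} (hf : ContinuousOn f (univ ×ˢ univ ×ˢ P i))
    {p₀ : D.Params} (hp₀ : p₀ ∈ D.feasible P) {p : ι → D.Params}
    (hp : Tendsto p l (𝓝[D.feasible P] p₀)) {x y : ι → VState d} {x₀ y₀ : VState d}
    (hx : Tendsto x l (𝓝 x₀)) (hy : Tendsto y l (𝓝 y₀)) :
    Tendsto (fun a => f (x a, y a, p a i)) l (𝓝 (f (x₀, y₀, p₀ i))) := by
  refine (hf (x₀, y₀, p₀ i) ⟨mem_univ _, mem_univ _, hp₀ i (mem_univ i)⟩).tendsto.comp ?_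
  have hpi := tendsto_nhdsWithin_iff.1 ((tendsto_apply_nhdsWithin i).comp hp)
  exact tendsto_nhdsWithin_iff.2 ⟨hx.prodMk_nhds (hy.prodMk_nhds hpi.1),
    hpi.2.mono fun a ha => ⟨mem_univ _, mem_univ _, ha⟩⟩

lemma ModelRegular.norm_model_sub_le (hm : D.ModelRegular P) {p : D.Params}
    (hp : p ∈ D.feasible P) {R B : ℝ} {i : Fin n} {r : Fin (D.nReg i)}
    (hB : ∀ x y, ‖x‖ ≤ R → ‖y‖ ≤ R →
      ‖fderiv ℝ (fun x' => D.model i r x' y (p i)) x‖ ≤ B ∧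
      ‖fderiv ℝ (fun y' => D.model i r x y' (p i)) y‖ ≤ B)
    {x y x' y' : VState d} (hx : ‖x‖ ≤ R) (hy : ‖y‖ ≤ R) (hx' : ‖x'‖ ≤ R) (hy' : ‖y'‖ ≤ R) :
    ‖D.model i r x y (p i) - D.model i r x' y' (p i)‖ ≤ B * ‖x - x'‖ + B * ‖y - y'‖ := by
  have hpi := hp i (mem_univ i)
  have h1 := (convex_closedBall (0 : VState d) R).norm_image_sub_le_of_norm_fderiv_le (𝕜 := ℝ)
    (f := fun x' => D.model i r x' y (p i)) (fun z _ => hm.diff_x i r z y _ hpi)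
    (fun z hz => (hB z y (by simpa using hz) hy).1) (x := x') (y := x)
    (by simpa using hx') (by simpa using hx)
  have h2 := (convex_closedBall (0 : VState d) R).norm_image_sub_le_of_norm_fderiv_le (𝕜 := ℝ)
    (f := fun y => D.model i r x' y (p i)) (fun z _ => hm.diff_lead i r x' z _ hpi)
    (fun z hz => (hB x' z hx' (by simpa using hz)).2) (x := y') (y := y)
    (by simpa using hy') (by simpa using hy)
  refine (norm_sub_le_norm_sub_add_norm_sub _ (D.model i r x' y (p i)) _).trans ?_
  exact add_le_add h1 h2

end ModelBounds

end Platoon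

/-- Components of the solution of a system. -/
lemma IntegralSol.apply_eq {ι : Type*} [Fintype ι] {E : ι → Type*}
    [∀ i, NormedAddCommGroup (E i)] [∀ i, NormedSpace ℝ (E i)] [∀ i, CompleteSpace (E i)]
    {C M a b : ℝ} {g : ℝ → (∀ i, E i) → ∀ i, E i} {x₀ : ∀ i, E i} {x : ℝ → ∀ i, E i}
    (hg : LipField C M g) (hx : IntegralSol g a b x₀ x) {t : ℝ} (ht : t ∈ Icc a b) (i : ι) :
    x t i = x₀ i + ∫ s in a..t, g s (x s) i := by
  have h := ContinuousLinearMap.intervalIntegral_comp_comm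
    (ContinuousLinearMap.proj (R := ℝ) (φ := E) i) (hg.intervalIntegrable hx.cont a t)
  simp only [ContinuousLinearMap.proj_apply] at h
  conv_lhs => rw [hx.eq t ht]
  rw [h, Pi.add_apply]

namespace Platoon

variable {n d : ℕ} [NeZero d] {D : Platoon n d} {P : (i : Fin n) → Set (D.Par i)}

/-- The state of vehicle `i` at time `t` when its model has led it to the state `w` at time
`min t (tLead i)`. -/
def followState (D : Platoon n d) (i : Fin n) (t : ℝ) (w : VState d) : VState d :=
  if t ≤ D.tLead i then w
  else D.data i t + (w 0 - D.data i (D.tLead i) 0) • EuclideanSpace.single 0 (1 : ℝ)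

lemma norm_single_zero_one : ‖(EuclideanSpace.single 0 (1 : ℝ) : VState d)‖ = 1 := by simp

lemma norm_followState_sub_le (i : Fin n) (t : ℝ) (w w' : VState d) :
    ‖D.followState i t w - D.followState i t w'‖ ≤ ‖w - w'‖ := by
  unfold followState
  split_ifs
  · exact le_rfl
  · rw [add_sub_add_left_eq_sub, ← sub_smul, norm_smul, norm_single_zero_one, mul_one,
      sub_sub_sub_cancel_right]
    exact PiLp.norm_apply_le (w - w') 0

/-- The platoon trajectories that belong to the model states `W`. -/
def stateFamily (D : Platoon n d) (W : Fin n → VState d) (i : Fin n) (t : ℝ) : VState d :=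
  D.followState i t (W i)

lemma norm_lead_stateFamily_sub_le (W W' : Fin n → VState d) (i : Fin n) (t : ℝ) :
    ‖D.lead (D.stateFamily W) i t - D.lead (D.stateFamily W') i t‖ ≤ ‖W - W'‖ := by
  unfold lead
  cases D.leader i t with
  | none => simp
  | some k =>
    exact (norm_followState_sub_le k t _ _).trans (norm_le_pi_norm (W - W') k)

lemma tendsto_followState {ι : Type*} {l : Filter ι} {τ : ι → ℝ} {t₀ : ℝ} {w : ι → VState d}
    {w₀ : VState d} (hD : D.Admissible) (ht : D.GenericTime t₀) (hτ : Tendsto τ l (𝓝 t₀))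
    (hw : Tendsto w l (𝓝 w₀)) {i : Fin n} (hi : t₀ ∈ Icc (D.tStart i) (D.tEnd i)) :
    Tendsto (fun a => D.followState i (τ a) (w a)) l (𝓝 (D.followState i t₀ w₀)) := by
  rcases lt_or_gt_of_ne (ht i).2.1 with hlt | hgt
  · have h : ∀ᶠ a in l, w a = D.followState i (τ a) (w a) :=
      (hτ.eventually (gt_mem_nhds hlt)).mono fun a ha => by rw [followState, if_pos (le_of_lt ha)]
    rw [followState, if_pos hlt.le]
    exact hw.congr' h
  · have h : ∀ᶠ a in l, D.data i (τ a) + (w a 0 - D.data i (D.tLead i) 0) •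
        EuclideanSpace.single 0 (1 : ℝ) = D.followState i (τ a) (w a) :=
      (hτ.eventually (lt_mem_nhds hgt)).mono fun a ha => by
        rw [followState, if_neg (not_le.2 ha)]
    rw [followState, if_neg (not_le.2 hgt)]
    refine Tendsto.congr' h ?_
    have h0 : Tendsto (fun a => w a 0) l (𝓝 (w₀ 0)) :=
      ((EuclideanSpace.proj (𝕜 := ℝ) (0 : Fin d)).continuous.tendsto w₀).comp hw
    exact ((hD.continuousAt_data ht hi).tendsto.comp hτ).add
      ((h0.sub_const _).smul_const _)

/-- Bounds for what comes from outside the model: external leaders and measurements. -/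
def ExternalBound (D : Platoon n d) (B : ℝ) : Prop :=
  (∀ i, ∀ t ∈ Icc (D.tStart i) (D.tLead i), ‖D.extLead i t‖ ≤ B) ∧
  (∀ i, ∀ t ∈ Icc (D.tStart i) (D.tEnd i), ‖D.data i t‖ ≤ B) ∧
  ∀ i, ∀ t ∈ Icc (D.tStart i) (D.tEnd i), ∀ w, ‖D.followState i t w‖ ≤ ‖w‖ + B

lemma Admissible.exists_externalBound (hD : D.Admissible) : ∃ B, 0 ≤ B ∧ D.ExternalBound B := by
  choose B hB using fun i => (hD.ext_cont i).bounded
  choose B' hB' using fun i => isCompact_Icc.exists_bound_of_continuousOn (hD.data_cont i)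
  obtain ⟨M, hM⟩ := (Set.finite_range B).bddAbove
  obtain ⟨M', hM'⟩ := (Set.finite_range B').bddAbove
  have h1 : ∀ i, ∀ t ∈ Icc (D.tStart i) (D.tEnd i), ‖D.data i t‖ ≤ |M'| := fun i t ht =>
    ((hB' i t ht).trans (hM' (mem_range_self i))).trans (le_abs_self _)
  refine ⟨|M| + (|M'| + |M'|), by positivity, ?_, ?_, ?_⟩
  · intro i t ht
    have h2 := ((hB i t ht).trans (hM (mem_range_self i))).trans (le_abs_self _)
    linarith [abs_nonneg M']
  · intro i t ht
    have h2 := h1 i t ht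
    linarith [abs_nonneg M', abs_nonneg M]
  · intro i t ht w
    unfold followState
    split_ifs with h
    · linarith [abs_nonneg M', abs_nonneg M]
    · have h3 := h1 i (D.tLead i) ⟨hD.start_le_lead i, hD.lead_le_end i⟩
      have h4 := h1 i t ht
      have h5 : ‖w 0 - D.data i (D.tLead i) 0‖ ≤ ‖w‖ + ‖D.data i (D.tLead i)‖ :=
        (norm_sub_le _ _).trans (add_le_add (PiLp.norm_apply_le _ _) (PiLp.norm_apply_le _ _))
      have h6 := norm_add_le (D.data i t)
        ((w 0 - D.data i (D.tLead i) 0) • (EuclideanSpace.single 0 (1 : ℝ) : VState d))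
      rw [norm_smul, norm_single_zero_one, mul_one] at h6
      linarith [abs_nonneg M]

lemma ExternalBound.norm_lead_le {B : ℝ} (hB : D.ExternalBound B)
    {x : Fin n → ℝ → VState d} {i : Fin n} {t A : ℝ} (hA : 0 ≤ A)
    (hi : t ∈ Icc (D.tStart i) (D.tLead i))
    (hx : ∀ k, D.Follows i k t → ‖x k t‖ ≤ A + B) : ‖D.lead x i t‖ ≤ A + B := by
  unfold lead
  cases hl : D.leader i t with
  | none => exact (hB.1 i t hi).trans (by linarith)
  | some k => exact hx k ⟨hl, hi⟩

lemma ExternalBound.norm_lead_stateFamily_le {B : ℝ} (hB : D.ExternalBound B)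
    (hD : D.Admissible) (W : Fin n → VState d) {i : Fin n} {t : ℝ}
    (hi : t ∈ Icc (D.tStart i) (D.tLead i)) : ‖D.lead (D.stateFamily W) i t‖ ≤ ‖W‖ + B :=
  hB.norm_lead_le (norm_nonneg W) hi fun k hk =>
    (hB.2.2 k t (hD.leader_present i k t hk) (W k)).trans
      (by gcongr; exact norm_le_pi_norm W k)

/-- The right hand side of the platoon equations for the model states, with the states truncated
at `R`. -/
def field (D : Platoon n d) (p : D.Params) (r : (i : Fin n) → ℝ → Fin (D.nReg i)) (R t : ℝ)
    (W : Fin n → VState d) (i : Fin n) : VState d :=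
  indicator (Icc (D.tStart i) (D.tLead i)) (fun t => D.model i (r i t) (clampState R (W i))
    (clampState R (D.lead (D.stateFamily W) i t)) (p i)) t

lemma tendsto_field (hD : D.Admissible) (hm : D.ModelRegular P) {ι : Type*} {l : Filter ι}
    {p₀ : D.Params} (hp₀ : p₀ ∈ D.feasible P) {p : ι → D.Params}
    (hp : Tendsto p l (𝓝[D.feasible P] p₀)) {τ : ι → ℝ} {t₀ : ℝ} (ht : D.GenericTime t₀)
    (hτ : Tendsto τ l (𝓝 t₀)) {r₀ : (i : Fin n) → ℝ → Fin (D.nReg i)}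
    {r : ι → (i : Fin n) → ℝ → Fin (D.nReg i)}
    (hr : ∀ i, t₀ ∈ Ioo (D.tStart i) (D.tLead i) → ∀ᶠ a in l, r a i (τ a) = r₀ i t₀)
    {W : ι → Fin n → VState d} {W₀ : Fin n → VState d} (hW : Tendsto W l (𝓝 W₀)) (R : ℝ) :
    Tendsto (fun a => D.field (p a) (r a) R (τ a) (W a)) l (𝓝 (D.field p₀ r₀ R t₀ W₀)) := by
  have hWi := tendsto_pi_nhds.1 hW
  refine tendsto_pi_nhds.2 fun i => ?_
  unfold field
  by_cases hi : t₀ ∈ Icc (D.tStart i) (D.tLead i)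
  · have hi' := ht.mem_Ioo_lead hi
    rw [indicator_of_mem hi]
    have hlead := tendsto_lead (X := fun a => D.stateFamily (W a)) (x₀ := D.stateFamily W₀) hD ht
      hτ (fun k hk => tendsto_followState hD ht hτ (hWi k) hk) hi
    have hmain := tendsto_regime (hm.cont i (r₀ i t₀)) hp₀ hp
      (((continuous_clampState R).tendsto _).comp (hWi i))
      (((continuous_clampState R).tendsto _).comp hlead)
    refine hmain.congr' ?_
    filter_upwards [hr i hi', hτ.eventually (Ioo_mem_nhds hi'.1 hi'.2)] with a ha hmem
    rw [indicator_of_mem (Ioo_subset_Icc_self hmem), ha]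
    rfl
  · rw [indicator_of_notMem hi]
    refine tendsto_const_nhds.congr' ?_
    filter_upwards [hτ.eventually (isClosed_Icc.isOpen_compl.mem_nhds hi)] with a ha
    rw [indicator_of_notMem ha]

lemma aestronglyMeasurable_field (hD : D.Admissible) (hm : D.ModelRegular P)
    {p : D.Params} (hp : p ∈ D.feasible P) {r : (i : Fin n) → ℝ → Fin (D.nReg i)}
    (hr : D.FinitelySwitching r) (R : ℝ) {W : ℝ → Fin n → VState d} (hW : Continuous W) :
    AEStronglyMeasurable (fun s => D.field p r R s (W s)) volume := by
  obtain ⟨Z, hZ, hr⟩ := hr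
  refine aestronglyMeasurable_of_continuousAt_off_finite
    (hD.finite_not_genericTime.union hZ) fun t ht => ?_
  simp only [mem_union, mem_ofPred_eq, not_or, not_not] at ht
  exact tendsto_field hD hm hp (tendsto_nhdsWithin_iff.2 ⟨tendsto_const_nhds, .of_forall fun _ => hp⟩)
    ht.1 tendsto_id (r := fun _ => r) (fun i hi => hr i t hi ht.2) hW.continuousAt R

lemma eventually_lipField (hD : D.Admissible) (hm : D.ModelRegular P) {p₀ : D.Params}
    (hp₀ : p₀ ∈ D.feasible P) (R : ℝ) :
    ∃ C M, 0 ≤ C ∧ ∀ᶠ p in 𝓝[D.feasible P] p₀, ∀ r, D.FinitelySwitching r →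
      LipField C M (D.field p r R) := by
  obtain ⟨A, hA⟩ := exists_norm_clampState_le d R
  obtain ⟨B, hB0, hB⟩ := hm.eventually_bounds hp₀ A
  refine ⟨B + B, B, by positivity, ?_⟩
  filter_upwards [hB, self_mem_nhdsWithin] with p hp hpP r hr
  refine ⟨fun s W W' => ?_, fun s => ?_, fun W hW => aestronglyMeasurable_field hD hm hpP hr R hW⟩
  · refine (pi_norm_le_iff_of_nonneg (by positivity)).2 fun i => ?_
    rw [Pi.sub_apply]
    unfold field
    by_cases hi : s ∈ Icc (D.tStart i) (D.tLead i)
    · rw [indicator_of_mem hi, indicator_of_mem hi]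
      refine (hm.norm_model_sub_le hpP (fun x y hx hy =>
        ⟨(hp i (r i s) x y hx hy).2.1, (hp i (r i s) x y hx hy).2.2.1⟩)
        (hA _) (hA _) (hA _) (hA _)).trans ?_
      rw [add_mul]
      gcongr
      · exact (norm_clampState_sub_le R _ _).trans (norm_le_pi_norm (W - W') i)
      · exact (norm_clampState_sub_le R _ _).trans (norm_lead_stateFamily_sub_le W W' i s)
    · rw [indicator_of_notMem hi, indicator_of_notMem hi, sub_self, norm_zero]
      positivity
  · refine (pi_norm_le_iff_of_nonneg hB0).2 fun i => ?_
    unfold field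
    by_cases hi : s ∈ Icc (D.tStart i) (D.tLead i)
    · rw [indicator_of_mem hi]
      exact (hp i (r i s) _ _ (hA _) (hA _)).1
    · rwa [indicator_of_notMem hi, norm_zero]

/-- The states in which the vehicles enter. -/
def entryState (D : Platoon n d) (i : Fin n) : VState d := D.data i (D.tStart i)

lemma followState_apply (i : Fin n) {t : ℝ} (ht : D.tLead i < t) (w : VState d) (k : Fin d) :
    D.followState i t w k = if k = 0 then w 0 + (D.data i t 0 - D.data i (D.tLead i) 0)
      else D.data i t k := by
  rw [followState, if_neg (not_le.2 ht)]
  by_cases hk : k = 0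
  · subst hk
    simp
    ring
  · simp [hk]

variable {a b : ℝ} {p : D.Params} {r : (i : Fin n) → ℝ → Fin (D.nReg i)}

/-- A bounded solution of the truncated system yields platoon trajectories. -/
lemma solves_of_integralSol (hD : D.Admissible) (hab : D.Covers a b) {B R C M : ℝ}
    (hB0 : 0 ≤ B) (hB : D.ExternalBound B) (hL : LipField C M (D.field p r R))
    {W : ℝ → Fin n → VState d} (hW : IntegralSol (D.field p r R) a b D.entryState W)
    (hR : ∀ t ∈ Icc a b, ‖W t‖ + B ≤ R) :
    D.Solves p r fun i t => D.stateFamily (W t) i t := by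
  have hstate : ∀ i, ∀ t ≤ D.tLead i, D.stateFamily (W t) i t = W t i := fun i t ht => by
    rw [stateFamily, followState, if_pos ht]
  have hmem : ∀ i, ∀ t ∈ Icc (D.tStart i) (D.tLead i), t ∈ Icc a b := fun i t ht =>
    ⟨(hab i).1.trans ht.1, (ht.2.trans (hD.lead_le_end i)).trans (hab i).2⟩
  have hfield : ∀ i, ∀ t ∈ Icc (D.tStart i) (D.tLead i), D.field p r R t (W t) i =
      D.model i (r i t) (D.stateFamily (W t) i t) (D.lead (fun k t => D.stateFamily (W t) k t) i t)
        (p i) := by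
    intro i t ht
    have h1 := hR t (hmem i t ht)
    rw [field, indicator_of_mem ht, hstate i t ht.2,
      clampState_eq_self ((norm_le_pi_norm (W t) i).trans (by linarith)),
      clampState_eq_self ((hB.norm_lead_stateFamily_le hD (W t) ht).trans h1)]
    rfl
  have hind : ∀ i, (fun s => D.field p r R s (W s) i) =
      indicator (Icc (D.tStart i) (D.tLead i)) fun s => D.field p r R s (W s) i := by
    intro i
    funext s
    by_cases hs : s ∈ Icc (D.tStart i) (D.tLead i)
    · rw [indicator_of_mem hs]
    · rw [indicator_of_notMem hs, field, indicator_of_notMem hs]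
  have hint : ∀ i u v, IntervalIntegrable (fun s => D.field p r R s (W s) i) volume u v :=
    fun i u v => ⟨(ContinuousLinearMap.proj (R := ℝ) (φ := fun _ : Fin n => VState d)
        i).integrable_comp (hL.intervalIntegrable hW.cont u v).1,
      (ContinuousLinearMap.proj (R := ℝ) (φ := fun _ : Fin n => VState d)
        i).integrable_comp (hL.intervalIntegrable hW.cont u v).2⟩
  intro i
  have hle := hD.start_le_lead i
  refine ⟨?_, fun t ht => ?_, fun t ht k => ?_⟩
  · refine (hint i (D.tStart i) (D.tLead i)).congr_uIoo fun s hs => hfield i s ?_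
    rw [uIoo_of_le hle] at hs
    exact Ioo_subset_Icc_self hs
  · simp only [hstate i t ht.2]
    rw [hW.apply_eq hL (hmem i t ht) i, hind i, integral_indicator_Icc (hab i).1 hle ht.1,
      min_eq_left ht.2, entryState]
    congr 1
    refine intervalIntegral.integral_congr_uIoo fun s hs => ?_
    rw [uIoo_of_le ht.1] at hs
    exact hfield i s ⟨hs.1.le, hs.2.le.trans ht.2⟩
  · have h1 : W t i = W (D.tLead i) i := by
      rw [hW.apply_eq hL ⟨((hab i).1.trans hle).trans ht.1.le, ht.2.trans (hab i).2⟩ i,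
        hW.apply_eq hL (hmem i _ (right_mem_Icc.2 hle)) i, hind i,
        integral_indicator_Icc (hab i).1 hle (hle.trans ht.1.le),
        integral_indicator_Icc (hab i).1 hle hle, min_eq_right ht.1.le, min_self]
    simp only [stateFamily] at *
    rw [followState_apply i ht.1, h1, hstate i _ le_rfl]

/-- Platoon trajectories come from a bounded solution of the truncated systems. -/
lemma Solves.exists_integralSol (hD : D.Admissible) (hab : D.Covers a b) {B : ℝ}
    (hB0 : 0 ≤ B) (hB : D.ExternalBound B) {x : Fin n → ℝ → VState d} (hx : D.Solves p r x) :
    ∃ W : ℝ → Fin n → VState d,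
      (∀ i, ∀ t ∈ Icc (D.tStart i) (D.tEnd i), x i t = D.stateFamily (W t) i t) ∧
      ∃ R₀, (∀ t ∈ Icc a b, ‖W t‖ ≤ R₀) ∧
        ∀ R, R₀ + B ≤ R → IntegralSol (D.field p r R) a b D.entryState W := by
  let h : (i : Fin n) → ℝ → VState d := fun i s =>
    D.model i (r i s) (x i s) (D.lead x i s) (p i)
  let H : (i : Fin n) → ℝ → VState d := fun i => indicator (Icc (D.tStart i) (D.tLead i)) (h i)
  have hH : ∀ i, Integrable (H i) volume := fun i =>
    integrable_indicator_Icc (hD.start_le_lead i) (hx i).1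
  let W : ℝ → Fin n → VState d := fun t i => D.entryState i + ∫ s in a..t, H i s
  have hWc : Continuous W := continuous_pi fun i =>
    continuous_const.add (intervalIntegral.continuous_primitive
      (fun u v => (hH i).intervalIntegrable) a)
  have hW1 : ∀ i, ∀ t ∈ Icc (D.tStart i) (D.tLead i), W t i = x i t := by
    intro i t ht
    change D.entryState i + ∫ s in a..t, H i s = x i t
    rw [integral_indicator_Icc (hab i).1 (hD.start_le_lead i) ht.1, min_eq_left ht.2,
      (hx i).2.1 t ht, entryState]
  have hxW : ∀ i, ∀ t ∈ Icc (D.tStart i) (D.tEnd i), x i t = D.stateFamily (W t) i t := by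
    intro i t ht
    rcases le_or_gt t (D.tLead i) with hle | hgt
    · rw [stateFamily, followState, if_pos hle, hW1 i t ⟨ht.1, hle⟩]
    · have hl := hD.start_le_lead i
      have h1 : W t i = W (D.tLead i) i := by
        change D.entryState i + ∫ s in a..t, H i s = D.entryState i + ∫ s in a..(D.tLead i), H i s
        rw [integral_indicator_Icc (hab i).1 hl ht.1, integral_indicator_Icc (hab i).1 hl hl,
          min_eq_right hgt.le, min_self]
      ext k
      rw [stateFamily, followState_apply i hgt, (hx i).2.2 t ⟨hgt, ht.2⟩ k, h1,
        hW1 i _ (right_mem_Icc.2 hl)]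
  obtain ⟨R₀, hR₀⟩ := isCompact_Icc.exists_bound_of_continuousOn (s := Icc a b) hWc.continuousOn
  refine ⟨W, hxW, R₀, hR₀, fun R hR => ⟨hWc, fun t ht => ?_⟩⟩
  have hfield : ∀ s ∈ Icc a b, D.field p r R s (W s) = fun i => H i s := by
    intro s hs
    funext i
    simp only [field, H]
    by_cases hi : s ∈ Icc (D.tStart i) (D.tLead i)
    · have hW0 := hR₀ s hs
      have hlead : D.lead (D.stateFamily (W s)) i s = D.lead x i s := by
        unfold lead
        cases hl : D.leader i s with
        | none => rfl
        | some k => exact (hxW k s (hD.leader_present i k s ⟨hl, hi⟩)).symm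
      rw [indicator_of_mem hi, indicator_of_mem hi,
        clampState_eq_self ((norm_le_pi_norm (W s) i).trans (by linarith)),
        clampState_eq_self ((hB.norm_lead_stateFamily_le hD (W s) hi).trans (by linarith)),
        hlead, hW1 i s hi]
    · rw [indicator_of_notMem hi, indicator_of_notMem hi]
  have hcong : ∫ s in a..t, D.field p r R s (W s) = ∫ s in a..t, fun i => H i s := by
    refine intervalIntegral.integral_congr fun s hs => hfield s ?_
    rw [uIcc_of_le ht.1] at hs
    exact ⟨hs.1, hs.2.trans ht.2⟩
  rw [hcong]
  funext i
  have hpi : IntervalIntegrable (fun s i => H i s) volume a t :=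
    (Integrable.of_eval fun i => hH i).intervalIntegrable
  have := ContinuousLinearMap.intervalIntegral_comp_comm
    (ContinuousLinearMap.proj (R := ℝ) (φ := fun _ : Fin n => VState d) i) hpi
  simp only [ContinuousLinearMap.proj_apply] at this
  rw [Pi.add_apply, ← this]

/-- Platoon trajectories for a given regime signal are unique. -/
lemma Solves.unique (hD : D.Admissible) (hm : D.ModelRegular P) (hp : p ∈ D.feasible P)
    (hr : D.FinitelySwitching r) {x y : Fin n → ℝ → VState d} (hx : D.Solves p r x)
    (hy : D.Solves p r y) {i : Fin n} {t : ℝ} (ht : t ∈ Icc (D.tStart i) (D.tEnd i)) :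
    x i t = y i t := by
  obtain ⟨T, -, hT⟩ := D.exists_covers
  obtain ⟨B, hB0, hB⟩ := hD.exists_externalBound
  obtain ⟨W, hxW, R₁, -, hW⟩ := hx.exists_integralSol hD hT hB0 hB
  obtain ⟨V, hyV, R₂, -, hV⟩ := hy.exists_integralSol hD hT hB0 hB
  set R := max (R₁ + B) (R₂ + B)
  obtain ⟨C, M, hC, hL⟩ := eventually_lipField hD hm hp R
  have hL' := hL.self_of_nhdsWithin hp r hr
  rw [hxW i t ht, hyV i t ht, IntegralSol.unique hL' hC (hW R (le_max_left _ _))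
    (hV R (le_max_right _ _)) t ⟨(hT i).1.trans ht.1, ht.2.trans (hT i).2⟩]

end Platoon

namespace Platoon

variable {n d : ℕ} [NeZero d] {D : Platoon n d} {P : (i : Fin n) → Set (D.Par i)}
variable {a b : ℝ} {p : D.Params} {r : (i : Fin n) → ℝ → Fin (D.nReg i)}

/-- Linear growth in the own state, uniformly in the truncation radius. -/
lemma exists_norm_field_le (hm : D.ModelRegular P) (hbdd : D.DxBounded P)
    (hp : p ∈ D.feasible P) (r : (i : Fin n) → ℝ → Fin (D.nReg i)) :
    ∃ C, 0 ≤ C ∧ ∀ A, ∃ M, 0 ≤ M ∧ ∀ R, 0 ≤ R → ∀ s W i,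
      (s ∈ Icc (D.tStart i) (D.tLead i) → ‖D.lead (D.stateFamily W) i s‖ ≤ A) →
      ‖D.field p r R s W i‖ ≤ C * ‖W i‖ + M := by
  obtain ⟨C, hC0, hC⟩ := exists_common_bound (α := Fin n) (l := pure p)
    (Q := fun i p B => ∀ r x y, ‖fderiv ℝ (fun x' => D.model i r x' y (p i)) x‖ ≤ B)
    (fun i p B B' hBB' h r x y => (h r x y).trans hBB') (fun i => by
      obtain ⟨C, hC⟩ := hbdd i (p i) (hp i (mem_univ i))
      exact ⟨C, eventually_pure.2 (hC.self_of_nhdsWithin (hp i (mem_univ i)))⟩)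
  rw [eventually_pure] at hC
  refine ⟨C, hC0, fun A => ?_⟩
  obtain ⟨M, hM0, hM⟩ := hm.eventually_bounds hp (max A 0)
  have hM' := hM.self_of_nhdsWithin hp
  refine ⟨M, hM0, fun R hR s W i hlead => ?_⟩
  unfold field
  by_cases hi : s ∈ Icc (D.tStart i) (D.tLead i)
  · rw [indicator_of_mem hi]
    set x := clampState R (W i)
    set y := clampState R (D.lead (D.stateFamily W) i s)
    have hy : ‖y‖ ≤ max A 0 :=
      ((norm_clampState_le hR _).trans (hlead hi)).trans (le_max_left _ _)
    have h1 := (hM' i (r i s) 0 y (by simp) hy).1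
    have h2 := convex_univ.norm_image_sub_le_of_norm_fderiv_le (𝕜 := ℝ)
      (f := fun x' => D.model i (r i s) x' y (p i))
      (fun z _ => hm.diff_x i (r i s) z y _ (hp i (mem_univ i)))
      (fun z _ => hC i (r i s) z y) (mem_univ 0) (mem_univ x)
    rw [sub_zero] at h2
    have h3 := norm_le_norm_sub_add (D.model i (r i s) x y (p i)) (D.model i (r i s) 0 y (p i))
    have h4 : C * ‖x‖ ≤ C * ‖W i‖ := by gcongr; exact norm_clampState_le hR _
    linarith
  · rw [indicator_of_notMem hi, norm_zero]
    positivity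

/-- Grönwall's inequality for one vehicle, between two times. -/
lemma norm_apply_le_of_integralSol {C₀ M₀ C M B R u v : ℝ} (hC : 0 ≤ C)
    (hM : 0 ≤ M) (hB : 0 ≤ B) (hL : LipField C₀ M₀ (D.field p r R)) {W : ℝ → Fin n → VState d}
    (hW : IntegralSol (D.field p r R) a b D.entryState W) {i : Fin n} (hau : a ≤ u)
    (hu : ‖W u i‖ ≤ B)
    (hf : ∀ s ∈ Ioo u v, s ∈ Icc a b → ‖D.field p r R s (W s) i‖ ≤ C * ‖W s i‖ + M)
    {t : ℝ} (ht : t ∈ Icc a b) (hut : u ≤ t) (htv : t ≤ v) :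
    ‖W t i‖ ≤ (B + M * (v - u)) * Real.exp (C * (v - u)) := by
  have hWi : Continuous fun s => W s i := (continuous_apply i).comp hW.cont
  have hint : ∀ u v, IntervalIntegrable (fun s => D.field p r R s (W s) i) volume u v :=
    fun u v => ⟨(ContinuousLinearMap.proj (R := ℝ) (φ := fun _ : Fin n => VState d)
        i).integrable_comp (hL.intervalIntegrable hW.cont u v).1,
      (ContinuousLinearMap.proj (R := ℝ) (φ := fun _ : Fin n => VState d)
        i).integrable_comp (hL.intervalIntegrable hW.cont u v).2⟩
  have key := le_mul_exp_of_le_add_integral (φ := fun s => ‖W s i‖) hWi.norm (a := u) (b := t)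
    (C := C) (δ := B + M * (v - u)) hC ?_ t (right_mem_Icc.2 hut)
  · refine key.trans ?_
    have : 0 ≤ M * (v - u) := mul_nonneg hM (by linarith)
    gcongr
  · intro s hs
    have hsI : s ∈ Icc a b := ⟨hau.trans hs.1, hs.2.trans ht.2⟩
    have h1 : W s i - W u i = ∫ σ in u..s, D.field p r R σ (W σ) i := by
      rw [hW.apply_eq hL hsI i, hW.apply_eq hL ⟨hau, hs.1.trans hsI.2⟩ i, add_sub_add_left_eq_sub,
        intervalIntegral.integral_interval_sub_left (hint _ _) (hint _ _)]
    have hci : IntervalIntegrable (fun σ => C * ‖W σ i‖) volume u s :=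
      (by fun_prop : Continuous fun σ => C * ‖W σ i‖).intervalIntegrable _ _
    have h2 : ‖W s i - W u i‖ ≤ ∫ σ in u..s, (C * ‖W σ i‖ + M) := by
      rw [h1]
      refine intervalIntegral.norm_integral_le_of_norm_le hs.1 ?_ (hci.add (by simp))
      have hne : ∀ᵐ σ : ℝ, σ ≠ v := by simp [ae_iff]
      filter_upwards [hne] with σ hσ hmem
      have h3 := hmem.2.trans hs.2
      exact hf σ ⟨hmem.1, lt_of_le_of_ne (h3.trans htv) hσ⟩ ⟨hau.trans hmem.1.le, h3.trans ht.2⟩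
    rw [intervalIntegral.integral_add hci (by simp), intervalIntegral.integral_const_mul,
      intervalIntegral.integral_const, smul_eq_mul] at h2
    have h4 := norm_le_norm_sub_add (W s i) (W u i)
    have h5 : (s - u) * M ≤ M * (v - u) := by
      rw [mul_comm]
      exact mul_le_mul_of_nonneg_left (by linarith [hs.2]) hM
    linarith

/-- The acyclicity of the leader relation prevents blow-up. -/
lemma exists_apriori_bound (hD : D.Admissible) (hm : D.ModelRegular P) (hbdd : D.DxBounded P)
    (hp : p ∈ D.feasible P) (hr : D.FinitelySwitching r) (hab : a ≤ b) :
    ∃ B, ∀ R, 0 ≤ R → ∀ W, IntegralSol (D.field p r R) a b D.entryState W →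
      ∀ t ∈ Icc a b, ‖W t‖ ≤ B := by
  obtain ⟨Be, hBe0, hBe⟩ := hD.exists_externalBound
  obtain ⟨C, hC, hfield⟩ := exists_norm_field_le hm hbdd hp r
  let A : Fin n → ℝ → Prop := fun i T => ∃ B, 0 ≤ B ∧ ∀ R, 0 ≤ R → ∀ W,
    IntegralSol (D.field p r R) a b D.entryState W → ∀ t ∈ Icc a b, t ≤ T → ‖W t i‖ ≤ B
  have hlip : ∀ R, ∃ C M, LipField C M (D.field p r R) := fun R => by
    obtain ⟨C, M, -, h⟩ := eventually_lipField hD hm hp R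
    exact ⟨C, M, h.self_of_nhdsWithin hp r hr⟩
  have hA : ∀ i, A i b := by
    refine induction_on_breakpoints hD.finite_not_genericTime (a := a) (Q := fun T => ∀ i, A i T)
      (fun i => ?_) (fun u v hau huv hdisj hQ => ?_) hab
    · refine ⟨‖D.entryState i‖, norm_nonneg _, fun R _ W hW t ht hta => ?_⟩
      rw [le_antisymm hta ht.1, hW.eq a (left_mem_Icc.2 hab), intervalIntegral.integral_same,
        add_zero]
    · have hgen : ∀ t ∈ Ioo u v, D.GenericTime t := fun t ht => by
        by_contra hcon
        exact Set.disjoint_left.1 hdisj ht hcon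
      have hmid : (u + v) / 2 ∈ Ioo u v := ⟨by linarith, by linarith⟩
      obtain ⟨rank, hrank⟩ := hD.leader_order ((u + v) / 2)
      intro i
      obtain ⟨m, hmi⟩ : ∃ m, rank i = m := ⟨_, rfl⟩
      induction m using Nat.strong_induction_on generalizing i with
      | _ m ih =>
        obtain ⟨B, hB0, hB⟩ := hQ i
        -- linear growth between the breakpoints
        have hgrow : ∃ M, 0 ≤ M ∧ ∀ R, 0 ≤ R → ∀ W,
            IntegralSol (D.field p r R) a b D.entryState W → ∀ s ∈ Ioo u v, s ∈ Icc a b →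
            ‖D.field p r R s (W s) i‖ ≤ C * ‖W s i‖ + M := by
          by_cases hact : Ioo u v ⊆ Icc (D.tStart i) (D.tLead i)
          · have hlead : ∃ A, ∀ R, 0 ≤ R → ∀ W, IntegralSol (D.field p r R) a b D.entryState W →
                ∀ s ∈ Ioo u v, s ∈ Icc a b → ‖D.lead (D.stateFamily (W s)) i s‖ ≤ A := by
              cases hl : D.leader i ((u + v) / 2) with
              | none =>
                refine ⟨Be, fun R _ W _ s hs _ => ?_⟩
                rw [lead, leader_eq_of_forall_genericTime hgen hact hs hmid, hl]
                exact hBe.1 i s (hact hs)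
              | some k =>
                obtain ⟨B', -, hB'⟩ := ih (rank k) (hmi ▸ hrank i k ⟨hl, hact hmid⟩) k rfl
                refine ⟨B' + Be, fun R hR W hW s hs hsI => ?_⟩
                have hls : D.leader i s = some k :=
                  (leader_eq_of_forall_genericTime hgen hact hs hmid).trans hl
                rw [lead, hls]
                refine (hBe.2.2 k s (hD.leader_present i k s ⟨hls, hact hs⟩) _).trans ?_
                gcongr
                exact hB' R hR W hW s hsI hs.2.le
            obtain ⟨A, hA⟩ := hlead
            obtain ⟨M, hM0, hM⟩ := hfield A
            exact ⟨M, hM0, fun R hR W hW s hs hsI =>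
              hM R hR s (W s) i fun _ => hA R hR W hW s hs hsI⟩
          · refine ⟨0, le_rfl, fun R _ W _ s hs _ => ?_⟩
            have hout : s ∉ Icc (D.tStart i) (D.tLead i) := by
              intro hmem
              refine hact fun σ hσ => ⟨?_, ?_⟩
              · by_contra! h
                exact (hgen (D.tStart i) ⟨hσ.1.trans h, hmem.1.trans_lt hs.2⟩ i).1 rfl
              · by_contra! h
                exact (hgen (D.tLead i) ⟨hs.1.trans_le hmem.2, h.trans hσ.2⟩ i).2.1 rfl
            rw [field, indicator_of_notMem hout, norm_zero]
            positivity
        obtain ⟨M, hM0, hM⟩ := hgrow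
        have hvu : 0 ≤ v - u := by linarith
        refine ⟨max B ((B + M * (v - u)) * Real.exp (C * (v - u))), le_max_of_le_left hB0,
          fun R hR W hW t ht htv => ?_⟩
        rcases le_or_gt t u with htu | htu
        · exact (hB R hR W hW t ht htu).trans (le_max_left _ _)
        · obtain ⟨C₀, M₀, hL⟩ := hlip R
          exact (norm_apply_le_of_integralSol hC hM0 hB0 hL hW hau
            (hB R hR W hW u ⟨hau, htu.le.trans ht.2⟩ le_rfl)
            (hM R hR W hW) ht htu.le htv).trans (le_max_right _ _)
  choose B hB0 hB using hA
  refine ⟨∑ i, B i, fun R hR W hW t ht =>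
    (pi_norm_le_iff_of_nonneg (Finset.sum_nonneg fun i _ => hB0 i)).2 fun i => ?_⟩
  exact (hB i R hR W hW t ht ht.2).trans
    (Finset.single_le_sum (fun i _ => hB0 i) (Finset.mem_univ i))

/-- The platoon equations are solvable for each finitely switching regime signal. -/
lemma exists_solves (hD : D.Admissible) (hm : D.ModelRegular P) (hbdd : D.DxBounded P)
    (hp : p ∈ D.feasible P) (hr : D.FinitelySwitching r) : ∃ x, D.Solves p r x := by
  obtain ⟨T, hT0, hT⟩ := D.exists_covers
  obtain ⟨B, hB0, hB⟩ := hD.exists_externalBound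
  obtain ⟨A, hA⟩ := exists_apriori_bound hD hm hbdd hp hr (neg_le_self hT0)
  obtain ⟨C, M, hC, hL⟩ := eventually_lipField hD hm hp (|A| + B)
  have hL' := hL.self_of_nhdsWithin hp r hr
  obtain ⟨W, hW⟩ := hL'.exists_integralSol hC (neg_le_self hT0) D.entryState
  exact ⟨_, solves_of_integralSol hD hT hB0 hB hL' hW fun t ht =>
    add_le_add_left ((hA _ (by positivity) W hW t ht).trans (le_abs_self A)) B⟩

/-- Platoon trajectories that depend on the parameters continuously, at a fixed admissible `p₀`:
this is what the objective and its gradient need to know about them. -/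
structure ContinuousTrajectories (D : Platoon n d) (P : (i : Fin n) → Set (D.Par i))
    (p₀ : D.Params) (x : D.Params → Fin n → ℝ → VState d) : Prop where
  tendsto : ∀ i, ∀ t ∈ Icc (D.tStart i) (D.tEnd i),
    Tendsto (fun p => x p i t) (𝓝[D.feasible P] p₀) (𝓝 (x p₀ i t))
  bounded : ∃ B, 0 ≤ B ∧ ∀ᶠ p in 𝓝[D.feasible P] p₀, ∀ i, ∀ t ∈ Icc (D.tStart i) (D.tEnd i),
    ‖x p i t‖ ≤ B

lemma Solves.continuousAt (hD : D.Admissible) {x : Fin n → ℝ → VState d} (hx : D.Solves p r x)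
    {t : ℝ} (ht : D.GenericTime t) {i : Fin n} (hi : t ∈ Icc (D.tStart i) (D.tEnd i)) :
    ContinuousAt (x i) t := by
  obtain ⟨T, -, hT⟩ := D.exists_covers
  obtain ⟨B, hB0, hB⟩ := hD.exists_externalBound
  obtain ⟨W, hxW, R₁, -, hW⟩ := hx.exists_integralSol hD hT hB0 hB
  have hWc := (hW _ le_rfl).cont
  have h := tendsto_followState hD ht tendsto_id (((continuous_apply i).comp hWc).tendsto t) hi
  have hi' := ht.mem_Ioo_end hi
  rw [ContinuousAt, hxW i t hi]
  refine h.congr' ?_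
  filter_upwards [Ioo_mem_nhds hi'.1 hi'.2] with s hs
  exact (hxW i s (Ioo_subset_Icc_self hs)).symm

/-- Continuous dependence of the platoon trajectories on the parameters, when the regimes converge
almost everywhere. -/
lemma continuousTrajectories (hD : D.Admissible) (hm : D.ModelRegular P)
    {p₀ : D.Params} (hp₀ : p₀ ∈ D.feasible P) {x : D.Params → Fin n → ℝ → VState d}
    {r : D.Params → (i : Fin n) → ℝ → Fin (D.nReg i)}
    (hx : ∀ᶠ p in 𝓝[D.feasible P] p₀, D.Solves p (r p) (x p))
    (hr : ∀ᶠ p in 𝓝[D.feasible P] p₀, D.FinitelySwitching (r p))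
    (hlim : ∀ᵐ t, ∀ i, t ∈ Ioo (D.tStart i) (D.tLead i) →
      ∀ᶠ p in 𝓝[D.feasible P] p₀, r p i t = r p₀ i t) :
    D.ContinuousTrajectories P p₀ x := by
  obtain ⟨T, hT0, hT⟩ := D.exists_covers
  obtain ⟨B, hB0, hB⟩ := hD.exists_externalBound
  obtain ⟨W, hxW, R₀, hR₀, hW⟩ :=
    (hx.self_of_nhdsWithin hp₀).exists_integralSol hD hT hB0 hB
  set R := R₀ + 1 + B
  have hW₀ := hW R (by simp only [R]; linarith)
  obtain ⟨C, M, hC, hL⟩ := eventually_lipField hD hm hp₀ R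
  have hL₀ := hL.self_of_nhdsWithin hp₀ _ (hr.self_of_nhdsWithin hp₀)
  have hLr : ∀ᶠ p in 𝓝[D.feasible P] p₀, LipField C M (D.field p (r p) R) := by
    filter_upwards [hL, hr] with p h1 h2 using h1 _ h2
  have hgen : ∀ᵐ t, D.GenericTime t := by
    filter_upwards [hD.finite_not_genericTime.countable.ae_notMem volume] with t ht
    exact not_not.1 ht
  have hflim : ∀ᵐ s, Tendsto (fun p => D.field p (r p) R s (W s)) (𝓝[D.feasible P] p₀)
      (𝓝 (D.field p₀ (r p₀) R s (W s))) := by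
    filter_upwards [hgen, hlim] with s hs hs'
    exact tendsto_field hD hm hp₀ tendsto_id hs tendsto_const_nhds hs' tendsto_const_nhds R
  -- for parameters close to `p₀` the truncation is inactive
  have hclose : ∀ ε, 0 < ε → ∀ᶠ p in 𝓝[D.feasible P] p₀, ∃ V : ℝ → Fin n → VState d,
      (∀ t ∈ Icc (-T) T, ‖V t - W t‖ ≤ ε) ∧ ∀ i, ∀ t ∈ Icc (D.tStart i) (D.tEnd i),
        x p i t = D.stateFamily (V t) i t := by
    intro ε hε
    filter_upwards [hLr, hx, hr, self_mem_nhdsWithin,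
      IntegralSol.eventually_close hC (neg_le_self hT0) hLr hL₀ hW₀ hflim hε,
      IntegralSol.eventually_close hC (neg_le_self hT0) hLr hL₀ hW₀ hflim one_pos]
      with p hLp hxp hrp hp h1 h2
    obtain ⟨V, hV⟩ := hLp.exists_integralSol hC (neg_le_self hT0) D.entryState
    refine ⟨V, h1 V hV, fun i t ht => ?_⟩
    refine hxp.unique hD hm hp hrp (solves_of_integralSol hD hT hB0 hB hLp hV fun t ht => ?_) ht
    have h3 := norm_le_norm_sub_add (V t) (W t)
    have h4 := h2 V hV t ht
    have h5 := hR₀ t ht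
    simp only [R]
    linarith
  have hmem : ∀ i, ∀ t ∈ Icc (D.tStart i) (D.tEnd i), t ∈ Icc (-T) T := fun i t ht =>
    ⟨(hT i).1.trans ht.1, ht.2.trans (hT i).2⟩
  constructor
  · intro i t ht
    rw [Metric.tendsto_nhds]
    intro ε hε
    filter_upwards [hclose (ε / 2) (by positivity)] with p ⟨V, hV, hxV⟩
    rw [hxV i t ht, hxW i t ht, dist_eq_norm]
    have h1 := (norm_followState_sub_le (D := D) i t (V t i) (W t i)).trans
      ((norm_le_pi_norm (V t - W t) i).trans (hV t (hmem i t ht)))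
    exact h1.trans_lt (by linarith)
  · refine ⟨|R₀| + 1 + B, by positivity, ?_⟩
    filter_upwards [hclose 1 one_pos] with p ⟨V, hV, hxV⟩ i t ht
    rw [hxV i t ht]
    have h1 := hB.2.2 i t ht (V t i)
    have h2 := norm_le_pi_norm (V t) i
    rw [stateFamily]
    have h3 := norm_le_norm_sub_add (V t) (W t)
    have h4 := hV t (hmem i t ht)
    have h5 := hR₀ t (hmem i t ht)
    linarith [le_abs_self R₀]

end Platoon

lemma tendsto_comp_clm {E F G ι : Type*} [NormedAddCommGroup E] [NormedSpace ℝ E]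
    [NormedAddCommGroup F] [NormedSpace ℝ F] [NormedAddCommGroup G] [NormedSpace ℝ G]
    {l : Filter ι} {A : ι → F →L[ℝ] G} {A₀ : F →L[ℝ] G} {B : ι → E →L[ℝ] F} {B₀ : E →L[ℝ] F}
    (hA : Tendsto A l (𝓝 A₀)) (hB : Tendsto B l (𝓝 B₀)) :
    Tendsto (fun a => (A a).comp (B a)) l (𝓝 (A₀.comp B₀)) :=
  (isBoundedBilinearMap_comp.continuous.tendsto (A₀, B₀)).comp (hA.prodMk_nhds hB)

namespace Platoon

variable {n d : ℕ} {D : Platoon n d} {P : (i : Fin n) → Set (D.Par i)}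

/-- What is known about the regimes in force along simulated trajectories `x p` for `p` near
`p₀`. -/
structure ConvergentRegimes (D : Platoon n d) (P : (i : Fin n) → Set (D.Par i))
    (p₀ : D.Params) {K : Fin n → ℕ} (r : D.Params → (i : Fin n) → ℝ → Fin (K i)) : Prop where
  switching : ∀ᶠ p in 𝓝[D.feasible P] p₀, D.FinitelySwitching (r p)
  eventually_eq : ∀ᵐ t, ∀ i, t ∈ Ioo (D.tStart i) (D.tLead i) →
    ∀ᶠ p in 𝓝[D.feasible P] p₀, r p i t = r p₀ i t

lemma convergentRegimes_of_onSchedule {p₀ : D.Params} (hp₀ : p₀ ∈ D.feasible P) {K : Fin n → ℕ}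
    {r : D.Params → (i : Fin n) → ℝ → Fin (K i)} {N : ℕ} {θ : Fin (N + 1) → D.Params → ℝ}
    {ρ : (i : Fin n) → Fin N → Fin (K i)}
    (hθ : ∀ j, ContinuousWithinAt (θ j) (D.feasible P) p₀)
    (hr : ∀ᶠ p in 𝓝[D.feasible P] p₀, D.OnSchedule (fun j => θ j p) ρ (r p) ∧
      ∀ i, θ 0 p ≤ D.tStart i ∧ D.tLead i ≤ θ (Fin.last N) p) : D.ConvergentRegimes P p₀ r := by
  refine ⟨hr.mono fun p hp => hp.1.finitelySwitching hp.2, ?_⟩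
  obtain ⟨hr₀, hle⟩ := hr.self_of_nhdsWithin hp₀
  filter_upwards [(finite_range fun j => θ j p₀).countable.ae_notMem volume] with t ht i hi
  exact hr₀.eventually_eq (θ := fun p j => θ j p) (hr.mono fun p hp => hp.1) (hle i) hθ
    tendsto_const_nhds hi fun j h => ht ⟨j, h.symm⟩

section Simulation

variable [NeZero d]

lemma exists_isSimulated (hD : D.Admissible) (hm : D.ModelRegular P) (hbdd : D.DxBounded P)
    (hs : D.SwitchingContinuous P) {p : D.Params} (hp : p ∈ D.feasible P) :
    ∃ x, D.IsSimulated p x := by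
  obtain ⟨N, θ, ρ, σ, -, hev⟩ := hs p hp
  obtain ⟨hmono, hle, hsw⟩ := hev.self_of_nhdsWithin hp
  have hr : D.OnSchedule (fun j => θ j p) ρ
      (scheduleSignal (fun j => θ j p) ρ fun i => D.select i 0 0 (p i)) :=
    onSchedule_scheduleSignal hmono _
  obtain ⟨x, hx⟩ := exists_solves hD hm hbdd hp (hr.finitelySwitching hle)
  exact ⟨x, hx.of_onSchedule hD hr (hsw _ x hx (Or.inr hr)).1 hle⟩

lemma IsSimulated.unique (hD : D.Admissible) (hm : D.ModelRegular P)
    (hs : D.SwitchingContinuous P) {p : D.Params} (hp : p ∈ D.feasible P)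
    {x y : Fin n → ℝ → VState d} (hx : D.IsSimulated p x) (hy : D.IsSimulated p y) {i : Fin n}
    {t : ℝ} (ht : t ∈ Icc (D.tStart i) (D.tEnd i)) : x i t = y i t := by
  obtain ⟨N, θ, ρ, σ, -, hev⟩ := hs p hp
  obtain ⟨hmono, hle, hsw⟩ := hev.self_of_nhdsWithin hp
  have hrx := (hsw _ x hx (Or.inl rfl)).1
  have hry := (hsw _ y hy (Or.inl rfl)).1
  exact Solves.unique hD hm hp (hrx.finitelySwitching hle) hx
    (Solves.of_onSchedule hD hy hry hrx hle) ht

lemma SwitchingContinuous.convergentRegimes (hs : D.SwitchingContinuous P) {p₀ : D.Params}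
    (hp₀ : p₀ ∈ D.feasible P) {x : D.Params → Fin n → ℝ → VState d}
    (hx : ∀ p ∈ D.feasible P, D.IsSimulated p (x p)) :
    D.ConvergentRegimes P p₀ (fun p => D.activeRegime p (x p)) ∧
      D.ConvergentRegimes P p₀ (K := fun _ => D.nLoss) (fun p => D.activeLoss (x p)) := by
  obtain ⟨N, θ, ρ, σ, hθ, hev⟩ := hs p₀ hp₀
  constructor
  · refine convergentRegimes_of_onSchedule hp₀ (ρ := ρ) hθ ?_
    filter_upwards [hev, self_mem_nhdsWithin] with p hp hpP
    exact ⟨(hp.2.2 _ (x p) (hx p hpP) (Or.inl rfl)).1, hp.2.1⟩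
  · refine convergentRegimes_of_onSchedule hp₀ (ρ := σ) hθ ?_
    filter_upwards [hev, self_mem_nhdsWithin] with p hp hpP
    exact ⟨(hp.2.2 _ (x p) (hx p hpP) (Or.inl rfl)).2, hp.2.1⟩

end Simulation

/-- Joint convergence of parameters, times and trajectories to generic data, with the regimes in
force eventually the same. -/
structure TrajLimit (D : Platoon n d) (P : (i : Fin n) → Set (D.Par i)) {ι : Type*}
    (l : Filter ι) (p : ι → D.Params) (x : ι → Fin n → ℝ → VState d) (τ : ι → ℝ)
    (p₀ : D.Params) (x₀ : Fin n → ℝ → VState d) (t₀ : ℝ) : Prop where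
  mem : p₀ ∈ D.feasible P
  par : Tendsto p l (𝓝[D.feasible P] p₀)
  time : Tendsto τ l (𝓝 t₀)
  generic : D.GenericTime t₀
  state : ∀ i, t₀ ∈ Icc (D.tStart i) (D.tEnd i) →
    Tendsto (fun a => x a i (τ a)) l (𝓝 (x₀ i t₀))
  regime : ∀ i, t₀ ∈ Ioo (D.tStart i) (D.tLead i) →
    ∀ᶠ a in l, D.activeRegime (p a) (x a) i (τ a) = D.activeRegime p₀ x₀ i t₀
  lossRegime : ∀ i, t₀ ∈ Ioo (D.tStart i) (D.tLead i) →
    ∀ᶠ a in l, D.activeLoss (x a) i (τ a) = D.activeLoss x₀ i t₀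

namespace TrajLimit

variable {ι : Type*} {l : Filter ι} {p : ι → D.Params} {x : ι → Fin n → ℝ → VState d}
  {τ : ι → ℝ} {p₀ : D.Params} {x₀ : Fin n → ℝ → VState d} {t₀ : ℝ} {i : Fin n}

lemma tendsto_model (h : D.TrajLimit P l p x τ p₀ x₀ t₀) (hD : D.Admissible)
    (hi : t₀ ∈ Icc (D.tStart i) (D.tLead i)) {F : Type*} [TopologicalSpace F]
    {f : Fin (D.nReg i) → VState d × VState d × D.Par i → F}
    (hf : ∀ r, ContinuousOn (f r) (univ ×ˢ univ ×ˢ P i)) :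
    Tendsto (fun a => f (D.activeRegime (p a) (x a) i (τ a))
        (x a i (τ a), D.lead (x a) i (τ a), p a i)) l
      (𝓝 (f (D.activeRegime p₀ x₀ i t₀) (x₀ i t₀, D.lead x₀ i t₀, p₀ i))) := by
  refine (tendsto_regime (hf _) h.mem h.par (h.state i (hD.mem_Icc_end hi))
    (tendsto_lead hD h.generic h.time h.state hi)).congr' ?_
  filter_upwards [h.regime i (h.generic.mem_Ioo_lead hi)] with a ha
  rw [ha]

lemma tendsto_loss (h : D.TrajLimit P l p x τ p₀ x₀ t₀) (hD : D.Admissible)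
    (hi : t₀ ∈ Icc (D.tStart i) (D.tLead i)) {F : Type*} [TopologicalSpace F]
    {f : Fin D.nLoss → VState d × VState d × ℝ → F}
    (hf : ∀ s, ContinuousOn (f s) (univ ×ˢ univ ×ˢ Icc (D.tStart i) (D.tLead i))) :
    Tendsto (fun a => f (D.activeLoss (x a) i (τ a)) (x a i (τ a), D.data i (τ a), τ a)) l
      (𝓝 (f (D.activeLoss x₀ i t₀) (x₀ i t₀, D.data i t₀, t₀))) := by
  have hi' := h.generic.mem_Ioo_lead hi
  have hT : Tendsto (fun a => f (D.activeLoss x₀ i t₀) (x a i (τ a), D.data i (τ a), τ a)) l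
      (𝓝 (f (D.activeLoss x₀ i t₀) (x₀ i t₀, D.data i t₀, t₀))) := by
    refine (hf _ (x₀ i t₀, D.data i t₀, t₀) ⟨mem_univ _, mem_univ _, hi⟩).tendsto.comp
      (tendsto_nhdsWithin_iff.2 ⟨(h.state i (hD.mem_Icc_end hi)).prodMk_nhds
        (((hD.continuousAt_data h.generic (hD.mem_Icc_end hi)).tendsto.comp h.time).prodMk_nhds
          h.time), ?_⟩)
    filter_upwards [h.time.eventually (Ioo_mem_nhds hi'.1 hi'.2)] with a ha
    exact ⟨mem_univ _, mem_univ _, Ioo_subset_Icc_self ha⟩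
  refine hT.congr' ?_
  filter_upwards [h.lossRegime i hi'] with a ha
  rw [ha]

lemma modelDx (h : D.TrajLimit P l p x τ p₀ x₀ t₀) (hD : D.Admissible) (hm : D.ModelRegular P)
    (hi : t₀ ∈ Icc (D.tStart i) (D.tLead i)) :
    Tendsto (fun a => D.modelDx (p a) (x a) i (τ a)) l (𝓝 (D.modelDx p₀ x₀ i t₀)) :=
  h.tendsto_model hD hi (fun r => hm.cont_dx i r)

lemma modelDlead (h : D.TrajLimit P l p x τ p₀ x₀ t₀) (hD : D.Admissible)
    (hm : D.ModelRegular P) (hi : t₀ ∈ Icc (D.tStart i) (D.tLead i)) :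
    Tendsto (fun a => D.modelDlead (p a) (x a) i (τ a)) l (𝓝 (D.modelDlead p₀ x₀ i t₀)) :=
  h.tendsto_model hD hi (fun r => hm.cont_dlead i r)

lemma modelDpar (h : D.TrajLimit P l p x τ p₀ x₀ t₀) (hD : D.Admissible)
    (hm : D.ModelRegular P) (hi : t₀ ∈ Icc (D.tStart i) (D.tLead i)) :
    Tendsto (fun a => D.modelDpar (p a) (x a) i (τ a)) l (𝓝 (D.modelDpar p₀ x₀ i t₀)) :=
  h.tendsto_model hD hi (fun r => hm.cont_dpar i r)

lemma lossDx (h : D.TrajLimit P l p x τ p₀ x₀ t₀) (hD : D.Admissible) (hl : D.LossRegular)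
    (hi : t₀ ∈ Icc (D.tStart i) (D.tLead i)) :
    Tendsto (fun a => D.lossDx (x a) i (τ a)) l (𝓝 (D.lossDx x₀ i t₀)) :=
  h.tendsto_loss hD hi (fun s => hl.cont_dx i s)

lemma lossAlong (h : D.TrajLimit P l p x τ p₀ x₀ t₀) (hD : D.Admissible) (hl : D.LossRegular)
    (hi : t₀ ∈ Icc (D.tStart i) (D.tLead i)) :
    Tendsto (fun a => D.lossAlong (x a) i (τ a)) l (𝓝 (D.lossAlong x₀ i t₀)) :=
  h.tendsto_loss hD hi (fun s => hl.cont i s)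

lemma gradAlong (h : D.TrajLimit P l p x τ p₀ x₀ t₀) (hD : D.Admissible)
    (hm : D.ModelRegular P) (hi : t₀ ∈ Icc (D.tStart i) (D.tLead i))
    {lam : ι → Fin n → ℝ → (VState d →L[ℝ] ℝ)} {lam₀ : Fin n → ℝ → (VState d →L[ℝ] ℝ)}
    (hlam : Tendsto (fun a => lam a i (τ a)) l (𝓝 (lam₀ i t₀))) :
    Tendsto (fun a => D.gradAlong (p a) (x a) (lam a) i (τ a)) l
      (𝓝 (D.gradAlong p₀ x₀ lam₀ i t₀)) :=
  tendsto_comp_clm hlam (h.modelDpar hD hm hi)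

lemma follows (h : D.TrajLimit P l p x τ p₀ x₀ t₀) (k i : Fin n) :
    ∀ᶠ a in l, D.Follows k i (τ a) ↔ D.Follows k i t₀ := by
  by_cases hk : t₀ ∈ Icc (D.tStart k) (D.tLead k)
  · have hk' := h.generic.mem_Ioo_lead hk
    filter_upwards [h.time.eventually ((h.generic k).2.2.2 hk).1,
      h.time.eventually (Ioo_mem_nhds hk'.1 hk'.2)] with a ha hmem
    simp only [Follows, ha, hk, Ioo_subset_Icc_self hmem, and_true]
  · filter_upwards [h.time.eventually (isClosed_Icc.isOpen_compl.mem_nhds hk)] with a ha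
    exact ⟨fun hf => absurd hf.2 ha, fun hf => absurd hf.2 hk⟩

lemma adjointRhs (h : D.TrajLimit P l p x τ p₀ x₀ t₀) (hD : D.Admissible)
    (hm : D.ModelRegular P) (hl : D.LossRegular) (hi : t₀ ∈ Icc (D.tStart i) (D.tEnd i))
    {lam : ι → Fin n → ℝ → (VState d →L[ℝ] ℝ)} {lam₀ : Fin n → ℝ → (VState d →L[ℝ] ℝ)}
    (hlam : ∀ k, Tendsto (fun a => lam a k (τ a)) l (𝓝 (lam₀ k t₀))) :
    Tendsto (fun a => D.adjointRhs (p a) (x a) (lam a) i (τ a)) l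
      (𝓝 (D.adjointRhs p₀ x₀ lam₀ i t₀)) := by
  unfold Platoon.adjointRhs
  refine Tendsto.sub ?_ (tendsto_finsetSum _ fun k _ => ?_)
  · rcases lt_or_gt_of_ne (h.generic i).2.1 with hlt | hgt
    · rw [if_pos hlt.le]
      have hi' : t₀ ∈ Icc (D.tStart i) (D.tLead i) := ⟨hi.1, hlt.le⟩
      refine ((h.lossDx hD hl hi').sub (tendsto_comp_clm (hlam i) (h.modelDx hD hm hi'))).congr' ?_
      filter_upwards [h.time.eventually (gt_mem_nhds hlt)] with a ha
      rw [if_pos (le_of_lt ha)]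
    · rw [if_neg (not_le.2 hgt)]
      refine tendsto_const_nhds.congr' ?_
      filter_upwards [h.time.eventually (lt_mem_nhds hgt)] with a ha
      rw [if_neg (not_le.2 ha)]
  · by_cases hk : D.Follows k i t₀
    · rw [if_pos hk]
      refine (tendsto_comp_clm (hlam k) (h.modelDlead hD hm hk.2)).congr' ?_
      filter_upwards [h.follows k i] with a ha
      rw [if_pos (ha.2 hk)]
    · rw [if_neg hk]
      refine tendsto_const_nhds.congr' ?_
      filter_upwards [h.follows k i] with a ha
      rw [if_neg (mt ha.1 hk)]

end TrajLimit

section Adjoint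

/-- The adjoint system in reversed time, as a system on the whole line. -/
def adjointField (D : Platoon n d) (p : D.Params) (x : Fin n → ℝ → VState d) (s : ℝ)
    (Λ : Fin n → (VState d →L[ℝ] ℝ)) (i : Fin n) : VState d →L[ℝ] ℝ :=
  indicator (Icc (D.tStart i) (D.tEnd i))
    (fun t => -D.adjointRhs p x (fun k _ => Λ k) i t) (-s)

lemma TrajLimit.adjointField {ι : Type*} {l : Filter ι} {p : ι → D.Params}
    {x : ι → Fin n → ℝ → VState d} {τ : ι → ℝ} {p₀ : D.Params} {x₀ : Fin n → ℝ → VState d}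
    {t₀ : ℝ} (h : D.TrajLimit P l p x (fun a => -τ a) p₀ x₀ (-t₀)) (hD : D.Admissible)
    (hm : D.ModelRegular P) (hl : D.LossRegular)
    {Λ : ι → Fin n → (VState d →L[ℝ] ℝ)} {Λ₀ : Fin n → (VState d →L[ℝ] ℝ)}
    (hΛ : Tendsto Λ l (𝓝 Λ₀)) :
    Tendsto (fun a => D.adjointField (p a) (x a) (τ a) (Λ a)) l
      (𝓝 (D.adjointField p₀ x₀ t₀ Λ₀)) := by
  refine tendsto_pi_nhds.2 fun i => ?_
  unfold Platoon.adjointField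
  by_cases hi : -t₀ ∈ Icc (D.tStart i) (D.tEnd i)
  · have hi' := h.generic.mem_Ioo_end hi
    rw [indicator_of_mem hi]
    refine (h.adjointRhs hD hm hl hi (lam := fun a k _ => Λ a k) (lam₀ := fun k _ => Λ₀ k)
      (tendsto_pi_nhds.1 hΛ)).neg.congr' ?_
    filter_upwards [h.time.eventually (Ioo_mem_nhds hi'.1 hi'.2)] with a ha
    rw [indicator_of_mem (Ioo_subset_Icc_self ha)]
  · rw [indicator_of_notMem hi]
    refine tendsto_const_nhds.congr' ?_
    filter_upwards [h.time.eventually (isClosed_Icc.isOpen_compl.mem_nhds hi)] with a ha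
    rw [indicator_of_notMem ha]

lemma adjointRhs_congr {p : D.Params} {x : Fin n → ℝ → VState d}
    {lam mu : Fin n → ℝ → (VState d →L[ℝ] ℝ)} {i : Fin n} {t : ℝ} (hi : lam i t = mu i t)
    (hk : ∀ k, D.Follows k i t → lam k t = mu k t) :
    D.adjointRhs p x lam i t = D.adjointRhs p x mu i t := by
  unfold adjointRhs
  rw [hi]
  congr 1
  refine Finset.sum_congr rfl fun k _ => ?_
  split_ifs with h
  · rw [hk k h]
  · rfl

lemma norm_adjointRhs_sub_le {p : D.Params} {x : Fin n → ℝ → VState d} {B : ℝ} (hB0 : 0 ≤ B)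
    (hB : ∀ i, ∀ t ∈ Icc (D.tStart i) (D.tLead i),
      ‖D.modelDx p x i t‖ ≤ B ∧ ‖D.modelDlead p x i t‖ ≤ B)
    (Λ Λ' : Fin n → (VState d →L[ℝ] ℝ)) {i : Fin n} {t : ℝ} (hi : D.tStart i ≤ t) :
    ‖D.adjointRhs p x (fun k _ => Λ k) i t - D.adjointRhs p x (fun k _ => Λ' k) i t‖ ≤
      (B + n * B) * ‖Λ - Λ'‖ := by
  have hcomp : ∀ k (A : VState d →L[ℝ] VState d), ‖A‖ ≤ B →
      ‖(Λ k).comp A - (Λ' k).comp A‖ ≤ B * ‖Λ - Λ'‖ := by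
    intro k A hA
    rw [← ContinuousLinearMap.sub_comp, mul_comm]
    refine (ContinuousLinearMap.opNorm_comp_le _ _).trans ?_
    gcongr
    exact norm_le_pi_norm (Λ - Λ') k
  unfold adjointRhs
  rw [sub_sub_sub_comm, ← Finset.sum_sub_distrib, add_mul]
  refine (norm_sub_le _ _).trans (add_le_add ?_ ?_)
  · split_ifs with h
    · rw [sub_sub_sub_cancel_left, norm_sub_rev]
      exact hcomp i _ (hB i t ⟨hi, h⟩).1
    · rw [sub_self, norm_zero]
      positivity
  · refine (norm_sum_le _ _).trans ?_
    have hle : ∑ _ : Fin n, B * ‖Λ - Λ'‖ = n * B * ‖Λ - Λ'‖ := by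
      rw [Finset.sum_const, Finset.card_univ, Fintype.card_fin, nsmul_eq_mul, mul_assoc]
    rw [← hle]
    refine Finset.sum_le_sum fun k _ => ?_
    split_ifs with h
    · exact hcomp k _ (hB k t h.2).2
    · rw [sub_self, norm_zero]
      positivity

lemma lipField_adjointField {p : D.Params} {x : Fin n → ℝ → VState d} {B : ℝ} (hB0 : 0 ≤ B)
    (hB : ∀ i, ∀ t ∈ Icc (D.tStart i) (D.tLead i), ‖D.lossDx x i t‖ ≤ B ∧
      ‖D.modelDx p x i t‖ ≤ B ∧ ‖D.modelDlead p x i t‖ ≤ B)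
    (hmeas : ∀ Λ : ℝ → Fin n → (VState d →L[ℝ] ℝ), Continuous Λ →
      AEStronglyMeasurable (fun s => D.adjointField p x s (Λ s)) volume) :
    LipField (B + n * B) B (D.adjointField p x) := by
  refine ⟨fun s Λ Λ' => ?_, fun s => ?_, hmeas⟩
  · refine (pi_norm_le_iff_of_nonneg (by positivity)).2 fun i => ?_
    rw [Pi.sub_apply]
    unfold adjointField
    by_cases hi : -s ∈ Icc (D.tStart i) (D.tEnd i)
    · rw [indicator_of_mem hi, indicator_of_mem hi, neg_sub_neg, norm_sub_rev]
      exact norm_adjointRhs_sub_le hB0 (fun i t ht => (hB i t ht).2) Λ Λ' hi.1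
    · rw [indicator_of_notMem hi, indicator_of_notMem hi, sub_self, norm_zero]
      positivity
  · refine (pi_norm_le_iff_of_nonneg hB0).2 fun i => ?_
    unfold adjointField
    by_cases hi : -s ∈ Icc (D.tStart i) (D.tEnd i)
    · rw [indicator_of_mem hi, norm_neg]
      unfold adjointRhs
      simp only [Pi.zero_apply, ContinuousLinearMap.zero_comp, ite_self, Finset.sum_const_zero,
        sub_zero]
      split_ifs with h
      · exact (hB i _ ⟨hi.1, h⟩).1
      · rwa [norm_zero]
    · rwa [indicator_of_notMem hi, norm_zero]

variable {p : D.Params} {x : Fin n → ℝ → VState d} {T : ℝ}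

lemma integral_adjoint_eq {F : ℝ → (VState d →L[ℝ] ℝ)} {i : Fin n} (hT : D.Covers (-T) T)
    {t : ℝ} (ht : t ∈ Icc (D.tStart i) (D.tEnd i)) :
    ∫ s in (-T)..(-t), indicator (Icc (D.tStart i) (D.tEnd i)) (fun t => -F t) (-s) =
      ∫ s in (D.tEnd i)..t, F s := by
  simp_rw [indicator_Icc_neg]
  rw [integral_indicator_Icc (neg_le_neg (hT i).2) (neg_le_neg (ht.1.trans ht.2))
    (neg_le_neg ht.2), min_eq_left (neg_le_neg ht.1), intervalIntegral.integral_neg,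
    intervalIntegral.integral_comp_neg (fun s => F s), neg_neg, neg_neg,
    ← intervalIntegral.integral_symm]

lemma isAdjoint_of_integralSol (hD : D.Admissible) (hT : D.Covers (-T) T) {C M : ℝ}
    (hL : LipField C M (D.adjointField p x)) {Λ : ℝ → Fin n → (VState d →L[ℝ] ℝ)}
    (hΛ : IntegralSol (D.adjointField p x) (-T) T 0 Λ) :
    D.IsAdjoint p x fun i t => Λ (-t) i := by
  intro i
  have hle := (hD.start_le_lead i).trans (hD.lead_le_end i)
  have hfield : ∀ s, D.adjointField p x s (Λ s) i = indicator (Icc (D.tStart i) (D.tEnd i))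
      (fun t => -D.adjointRhs p x (fun i t => Λ (-t) i) i t) (-s) := by
    intro s
    unfold adjointField
    by_cases hs : -s ∈ Icc (D.tStart i) (D.tEnd i)
    · rw [indicator_of_mem hs, indicator_of_mem hs]
      congr 1
      refine adjointRhs_congr ?_ fun k _ => ?_ <;> rw [neg_neg]
    · rw [indicator_of_notMem hs, indicator_of_notMem hs]
  refine ⟨?_, fun t ht => ?_⟩
  · have h1 : IntervalIntegrable (fun s => D.adjointField p x s (Λ s) i) volume
        (-D.tStart i) (-D.tEnd i) :=
      ⟨(ContinuousLinearMap.proj (R := ℝ) (φ := fun _ : Fin n => VState d →L[ℝ] ℝ)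
        i).integrable_comp (hL.intervalIntegrable hΛ.cont _ _).1,
      (ContinuousLinearMap.proj (R := ℝ) (φ := fun _ : Fin n => VState d →L[ℝ] ℝ)
        i).integrable_comp (hL.intervalIntegrable hΛ.cont _ _).2⟩
    rw [IntervalIntegrable.iff_comp_neg, neg_neg, neg_neg] at h1
    refine h1.neg.congr_uIoo fun s hs => ?_
    rw [uIoo_of_le hle] at hs
    simp only [Pi.neg_apply]
    rw [hfield, neg_neg, indicator_of_mem (Ioo_subset_Icc_self hs), neg_neg]
  · have hmem : -t ∈ Icc (-T) T :=
      ⟨neg_le_neg (ht.2.trans (hT i).2), neg_le.1 ((hT i).1.trans ht.1)⟩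
    change Λ (-t) i = _
    rw [hΛ.apply_eq hL hmem i]
    simp_rw [hfield]
    rw [integral_adjoint_eq hT ht, Pi.zero_apply, zero_add]

lemma IsAdjoint.exists_integralSol (hD : D.Admissible) (hT : D.Covers (-T) T)
    {mu : Fin n → ℝ → (VState d →L[ℝ] ℝ)} (hmu : D.IsAdjoint p x mu) :
    ∃ Λ, IntegralSol (D.adjointField p x) (-T) T 0 Λ ∧
      ∀ i, ∀ t ∈ Icc (D.tStart i) (D.tEnd i), mu i t = Λ (-t) i := by
  let H : Fin n → ℝ → (VState d →L[ℝ] ℝ) := fun i s =>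
    indicator (Icc (D.tStart i) (D.tEnd i)) (fun t => -D.adjointRhs p x mu i t) (-s)
  have hH : ∀ i, Integrable (H i) volume := fun i =>
    (integrable_indicator_Icc ((hD.start_le_lead i).trans (hD.lead_le_end i))
      (hmu i).1.neg).comp_neg
  let Λ : ℝ → Fin n → (VState d →L[ℝ] ℝ) := fun t i => ∫ s in (-T)..t, H i s
  have hΛc : Continuous Λ := continuous_pi fun i =>
    intervalIntegral.continuous_primitive (fun u v => (hH i).intervalIntegrable) (-T)
  have hmuΛ : ∀ i, ∀ t ∈ Icc (D.tStart i) (D.tEnd i), mu i t = Λ (-t) i := fun i t ht => by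
    rw [(hmu i).2 t ht]
    exact (integral_adjoint_eq hT ht).symm
  refine ⟨Λ, ⟨hΛc, fun t _ => ?_⟩, hmuΛ⟩
  have hfield : ∀ s, D.adjointField p x s (Λ s) = fun i => H i s := by
    intro s
    funext i
    simp only [adjointField, H]
    by_cases hs : -s ∈ Icc (D.tStart i) (D.tEnd i)
    · rw [indicator_of_mem hs, indicator_of_mem hs]
      congr 1
      refine adjointRhs_congr ?_ fun k hk => ?_
      · rw [hmuΛ i _ hs, neg_neg]
      · rw [hmuΛ k _ (hD.mem_Icc_end hk.2), neg_neg]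
    · rw [indicator_of_notMem hs, indicator_of_notMem hs]
  simp_rw [hfield]
  funext i
  have hpi : IntervalIntegrable (fun s i => H i s) volume (-T) t :=
    (Integrable.of_eval fun i => hH i).intervalIntegrable
  have := ContinuousLinearMap.intervalIntegral_comp_comm
    (ContinuousLinearMap.proj (R := ℝ) (φ := fun _ : Fin n => VState d →L[ℝ] ℝ) i) hpi
  simp only [ContinuousLinearMap.proj_apply] at this
  rw [Pi.add_apply, ← this, Pi.zero_apply, zero_add]

end Adjoint

end Platoon

namespace Platoon

variable {n d : ℕ} {D : Platoon n d} {P : (i : Fin n) → Set (D.Par i)}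

lemma LossRegular.exists_bound (hl : D.LossRegular) (R : ℝ) :
    ∃ B, ∀ i s x z, ∀ t ∈ Icc (D.tStart i) (D.tLead i), ‖x‖ ≤ R → ‖z‖ ≤ R →
      ‖D.loss s x z t‖ ≤ B ∧ ‖fderiv ℝ (fun x' => D.loss s x' z t) x‖ ≤ B := by
  have h := exists_common_bound (α := Fin n × Fin D.nLoss) (l := pure ())
    (Q := fun a _ B => ∀ x z, ∀ t ∈ Icc (D.tStart a.1) (D.tLead a.1), ‖x‖ ≤ R → ‖z‖ ≤ R →
      ‖D.loss a.2 x z t‖ ≤ B ∧ ‖fderiv ℝ (fun x' => D.loss a.2 x' z t) x‖ ≤ B) ?_ ?_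
  · obtain ⟨B, -, hB⟩ := h
    exact ⟨B, fun i s => eventually_pure.1 hB (i, s)⟩
  · intro a _ B B' hBB' h x z t ht hx hz
    exact ⟨(h x z t ht hx hz).1.trans hBB', (h x z t ht hx hz).2.trans hBB'⟩
  · rintro ⟨i, s⟩
    set K : Set (VState d × VState d × ℝ) := Metric.closedBall (0 : VState d) R ×ˢ
      Metric.closedBall (0 : VState d) R ×ˢ Icc (D.tStart i) (D.tLead i)
    have hK : IsCompact K :=
      (isCompact_closedBall _ _).prod ((isCompact_closedBall _ _).prod isCompact_Icc)
    have hsub : K ⊆ univ ×ˢ univ ×ˢ Icc (D.tStart i) (D.tLead i) :=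
      fun w hw => ⟨mem_univ _, mem_univ _, hw.2.2⟩
    obtain ⟨B₁, h₁⟩ := hK.exists_bound_of_continuousOn ((hl.cont i s).mono hsub)
    obtain ⟨B₂, h₂⟩ := hK.exists_bound_of_continuousOn ((hl.cont_dx i s).mono hsub)
    refine ⟨max B₁ B₂, eventually_pure.2 fun x z t ht hx hz => ?_⟩
    have hmem : (x, z, t) ∈ K := ⟨by simpa using hx, by simpa using hz, ht⟩
    exact ⟨(h₁ _ hmem).trans (le_max_left _ _), (h₂ _ hmem).trans (le_max_right _ _)⟩

/-- An integral over the time in which a vehicle follows its model depends continuously on the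
parameters if its integrand does so at almost every time. -/
lemma continuousWithinAt_integral {F : Type*} [NormedAddCommGroup F] [NormedSpace ℝ F] {i : Fin n}
    (hD : D.Admissible) {p₀ : D.Params} {f : D.Params → ℝ → F} {B : ℝ}
    (hint : ∀ p ∈ D.feasible P, IntervalIntegrable (f p) volume (D.tStart i) (D.tLead i))
    (hB : ∀ᶠ p in 𝓝[D.feasible P] p₀, ∀ t ∈ Icc (D.tStart i) (D.tLead i), ‖f p t‖ ≤ B)
    (hlim : ∀ᵐ t, t ∈ Icc (D.tStart i) (D.tLead i) →
      Tendsto (fun p => f p t) (𝓝[D.feasible P] p₀) (𝓝 (f p₀ t))) :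
    ContinuousWithinAt (fun p => ∫ t in (D.tStart i)..(D.tLead i), f p t) (D.feasible P) p₀ := by
  have hsub : uIoc (D.tStart i) (D.tLead i) ⊆ Icc (D.tStart i) (D.tLead i) := by
    rw [uIoc_of_le (hD.start_le_lead i)]
    exact Ioc_subset_Icc_self
  refine intervalIntegral.tendsto_integral_filter_of_dominated_convergence (fun _ => B) ?_ ?_
    intervalIntegrable_const ?_
  · filter_upwards [self_mem_nhdsWithin] with p hp
    exact (intervalIntegrable_iff.1 (hint p hp)).aestronglyMeasurable
  · filter_upwards [hB] with p hp
    exact Eventually.of_forall fun t ht => hp t (hsub ht)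
  · filter_upwards [hlim] with t ht hmem
    exact ht (hsub hmem)

/-- At almost every time all coefficients converge as the parameters do. -/
lemma ContinuousTrajectories.ae_trajLimit (hD : D.Admissible) {p₀ : D.Params}
    (hp₀ : p₀ ∈ D.feasible P) {x : D.Params → Fin n → ℝ → VState d}
    (hx : D.ContinuousTrajectories P p₀ x)
    (hr : D.ConvergentRegimes P p₀ fun p => D.activeRegime p (x p))
    (hs : D.ConvergentRegimes P p₀ (K := fun _ => D.nLoss) fun p => D.activeLoss (x p)) :
    ∀ᵐ t, D.TrajLimit P (𝓝[D.feasible P] p₀) (fun p => p) x (fun _ => t) p₀ (x p₀) t := by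
  filter_upwards [hD.finite_not_genericTime.countable.ae_notMem volume, hr.eventually_eq,
    hs.eventually_eq] with t ht h1 h2
  have hg : D.GenericTime t := not_not.1 ht
  exact ⟨hp₀, tendsto_id, tendsto_const_nhds, hg, fun i hi => hx.tendsto i t hi, h1, h2⟩

variable [NeZero d]

lemma ContinuousTrajectories.eventually_coefficient_bounds (hD : D.Admissible)
    (hm : D.ModelRegular P) (hl : D.LossRegular) {p₀ : D.Params} (hp₀ : p₀ ∈ D.feasible P)
    {x : D.Params → Fin n → ℝ → VState d} (hx : D.ContinuousTrajectories P p₀ x) :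
    ∃ B, 0 ≤ B ∧ ∀ᶠ p in 𝓝[D.feasible P] p₀, ∀ i, ∀ t ∈ Icc (D.tStart i) (D.tLead i),
      ‖D.lossAlong (x p) i t‖ ≤ B ∧ ‖D.lossDx (x p) i t‖ ≤ B ∧ ‖D.modelDx p (x p) i t‖ ≤ B ∧
      ‖D.modelDlead p (x p) i t‖ ≤ B ∧ ‖D.modelDpar p (x p) i t‖ ≤ B := by
  obtain ⟨A, hA0, hA⟩ := hx.bounded
  obtain ⟨Be, hBe0, hBe⟩ := hD.exists_externalBound
  obtain ⟨B₁, h₁⟩ := hl.exists_bound (A + Be)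
  obtain ⟨B₂, hB₂, h₂⟩ := hm.eventually_bounds hp₀ (A + Be)
  refine ⟨max B₁ B₂, le_max_of_le_right hB₂, ?_⟩
  filter_upwards [hA, h₂] with p hA h₂ i t ht
  have ht' := hD.mem_Icc_end ht
  have hxt : ‖x p i t‖ ≤ A + Be := (hA i t ht').trans (by linarith)
  have hzt : ‖D.data i t‖ ≤ A + Be := (hBe.2.1 i t ht').trans (by linarith)
  have hyt : ‖D.lead (x p) i t‖ ≤ A + Be := hBe.norm_lead_le hA0 ht fun k hk =>
    (hA k t (hD.leader_present i k t hk)).trans (by linarith)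
  obtain ⟨h3, h4⟩ := h₁ i (D.activeLoss (x p) i t) _ _ t ht hxt hzt
  obtain ⟨-, h5, h6, h7⟩ := h₂ i (D.activeRegime p (x p) i t) _ _ hxt hyt
  exact ⟨h3.trans (le_max_left _ _), h4.trans (le_max_left _ _), h5.trans (le_max_right _ _),
    h6.trans (le_max_right _ _), h7.trans (le_max_right _ _)⟩

/-- Off a finite set of times all coefficients along a simulated trajectory are continuous in
time. -/
lemma IsSimulated.exists_trajLimit (hD : D.Admissible) {p : D.Params} (hp : p ∈ D.feasible P)
    {x : Fin n → ℝ → VState d} (hx : D.IsSimulated p x)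
    (hr : D.FinitelySwitching (D.activeRegime p x))
    (hs : D.FinitelySwitching (K := fun _ => D.nLoss) (D.activeLoss x)) :
    ∃ Z : Set ℝ, Z.Finite ∧ ∀ t, t ∉ Z → ∀ (l : Filter ℝ) (τ : ℝ → ℝ), Tendsto τ l (𝓝 t) →
      D.TrajLimit P l (fun _ => p) (fun _ => x) τ p x t := by
  obtain ⟨Z₁, hZ₁, h₁⟩ := hr
  obtain ⟨Z₂, hZ₂, h₂⟩ := hs
  refine ⟨_, (hD.finite_not_genericTime.union hZ₁).union hZ₂, fun t ht l τ hτ => ?_⟩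
  simp only [mem_union, mem_ofPred_eq, not_or, not_not] at ht
  exact
    { mem := hp
      par := tendsto_nhdsWithin_iff.2 ⟨tendsto_const_nhds, .of_forall fun _ => hp⟩
      time := hτ
      generic := ht.1.1
      state := fun i hi => (Solves.continuousAt hD hx ht.1.1 hi).tendsto.comp hτ
      regime := fun i hi => hτ.eventually (h₁ i t hi ht.1.2)
      lossRegime := fun i hi => hτ.eventually (h₂ i t hi ht.2) }

end Platoon

end

theorem theorem5p1 {n d : ℕ} [NeZero d] (D : Platoon n d) (P : (i : Fin n) → Set (D.Par i))
    (hD : D.Admissible)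
    (hloss : D.LossRegular)
    (hmodel : D.ModelRegular P)
    (hbdd : D.DxBounded P)
    (hswitch : D.SwitchingContinuous P) :
    ∃ (x : D.Params → Fin n → ℝ → VState d)
      (lam : D.Params → Fin n → ℝ → (VState d →L[ℝ] ℝ)),
      (∀ p ∈ D.feasible P,
        D.IsSimulated p (x p) ∧
        (∀ y, D.IsSimulated p y →
          ∀ i, ∀ t ∈ Set.Icc (D.tStart i) (D.tEnd i), y i t = x p i t) ∧
        D.IsAdjoint p (x p) (lam p) ∧
        (∀ mu, D.IsAdjoint p (x p) mu →
          ∀ i, ∀ t ∈ Set.Icc (D.tStart i) (D.tEnd i), mu i t = lam p i t) ∧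
        (∀ i, IntervalIntegrable (D.lossAlong (x p) i) MeasureTheory.volume
          (D.tStart i) (D.tLead i)) ∧
        (∀ i, IntervalIntegrable (D.gradAlong p (x p) (lam p) i) MeasureTheory.volume
          (D.tStart i) (D.tLead i))) ∧
      ContinuousOn (fun p => D.objective (x p)) (D.feasible P) ∧
      ContinuousOn (fun p => D.adjointGradient p (x p) (lam p)) (D.feasible P) := by
  obtain ⟨T, hT0, hT⟩ := D.exists_covers
  have hTT : -T ≤ T := neg_le_self hT0
  have hmem : ∀ i, ∀ t ∈ Icc (D.tStart i) (D.tEnd i), -t ∈ Icc (-T) T := fun i t ht =>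
    ⟨neg_le_neg (ht.2.trans (hT i).2), neg_le.1 ((hT i).1.trans ht.1)⟩
  -- the simulated trajectories
  have hsim : ∀ p, ∃ x, p ∈ D.feasible P → D.IsSimulated p x := fun p => by
    by_cases hp : p ∈ D.feasible P
    · obtain ⟨x, hx⟩ := Platoon.exists_isSimulated hD hmodel hbdd hswitch hp
      exact ⟨x, fun _ => hx⟩
    · exact ⟨fun _ _ => 0, fun h => absurd h hp⟩
  choose x hx using hsim
  have hreg := fun p₀ hp₀ => hswitch.convergentRegimes (p₀ := p₀) hp₀ hx
  have hcont : ∀ p₀ ∈ D.feasible P, D.ContinuousTrajectories P p₀ x := fun p₀ hp₀ =>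
    Platoon.continuousTrajectories hD hmodel hp₀ (eventually_mem_nhdsWithin.mono hx)
      (hreg p₀ hp₀).1.switching (hreg p₀ hp₀).1.eventually_eq
  have htime := fun p hp => (hx p hp).exists_trajLimit (P := P) hD hp
    ((hreg p hp).1.switching.self_of_nhdsWithin hp) ((hreg p hp).2.switching.self_of_nhdsWithin hp)
  -- the adjoint system
  have hmeas : ∀ p ∈ D.feasible P, ∀ Λ : ℝ → Fin n → (VState d →L[ℝ] ℝ), Continuous Λ →
      AEStronglyMeasurable (fun s => D.adjointField p (x p) s (Λ s)) volume := by
    intro p hp Λ hΛ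
    obtain ⟨Z, hZ, hlim⟩ := htime p hp
    refine aestronglyMeasurable_of_continuousAt_off_finite (hZ.preimage neg_injective.injOn)
      fun s hs => ?_
    exact (hlim (-s) hs (𝓝 s) _ (continuous_neg.tendsto s)).adjointField hD hmodel hloss
      (hΛ.tendsto s)
  have hlip : ∀ p₀ ∈ D.feasible P, ∃ B, 0 ≤ B ∧
      (∀ᶠ p in 𝓝[D.feasible P] p₀, ∀ i, ∀ t ∈ Icc (D.tStart i) (D.tLead i),
        ‖D.lossAlong (x p) i t‖ ≤ B ∧ ‖D.modelDpar p (x p) i t‖ ≤ B) ∧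
      ∀ᶠ p in 𝓝[D.feasible P] p₀, LipField (B + n * B) B (D.adjointField p (x p)) := by
    intro p₀ hp₀
    obtain ⟨B, hB0, hB⟩ := (hcont p₀ hp₀).eventually_coefficient_bounds hD hmodel hloss hp₀
    refine ⟨B, hB0, hB.mono fun p h i t ht => ⟨(h i t ht).1, (h i t ht).2.2.2.2⟩, ?_⟩
    filter_upwards [hB, self_mem_nhdsWithin] with p h hp
    exact Platoon.lipField_adjointField hB0
      (fun i t ht => ⟨(h i t ht).2.1, (h i t ht).2.2.1, (h i t ht).2.2.2.1⟩) (hmeas p hp)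
  have hadj : ∀ p, ∃ Λ, p ∈ D.feasible P → IntegralSol (D.adjointField p (x p)) (-T) T 0 Λ :=
    fun p => by
      by_cases hp : p ∈ D.feasible P
      · obtain ⟨B, hB0, -, hL⟩ := hlip p hp
        obtain ⟨Λ, hΛ⟩ :=
          (hL.self_of_nhdsWithin hp).exists_integralSol (by positivity) hTT 0
        exact ⟨Λ, fun _ => hΛ⟩
      · exact ⟨fun _ _ => 0, fun h => absurd h hp⟩
  choose Λ hΛ using hadj
  let lam : D.Params → Fin n → ℝ → (VState d →L[ℝ] ℝ) := fun p i t => Λ p (-t) i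
  have hlossInt : ∀ p ∈ D.feasible P, ∀ i,
      IntervalIntegrable (D.lossAlong (x p) i) volume (D.tStart i) (D.tLead i) := by
    intro p hp i
    obtain ⟨Z, hZ, hlim⟩ := htime p hp
    obtain ⟨B, hB0, hB, -⟩ := hlip p hp
    refine intervalIntegrable_of_continuousAt_off_finite hZ (hD.start_le_lead i)
      (fun t ht htZ => ?_) fun t ht => (hB.self_of_nhdsWithin hp i t ht).1
    exact (hlim t htZ (𝓝 t) _ tendsto_id).lossAlong hD hloss (Ioo_subset_Icc_self ht)
  -- the adjoint variables depend continuously on the parameters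
  have hclose : ∀ p₀ ∈ D.feasible P, ∀ ε, 0 < ε → ∀ᶠ p in 𝓝[D.feasible P] p₀,
      ∀ i, ∀ t ∈ Icc (D.tStart i) (D.tEnd i), ‖lam p i t - lam p₀ i t‖ ≤ ε := by
    intro p₀ hp₀ ε hε
    obtain ⟨B, hB0, -, hL⟩ := hlip p₀ hp₀
    have hlim := (hcont p₀ hp₀).ae_trajLimit hD hp₀ (hreg p₀ hp₀).1 (hreg p₀ hp₀).2
    have hneg := (Measure.measurePreserving_neg (volume : Measure ℝ)).quasiMeasurePreserving.ae hlim
    filter_upwards [self_mem_nhdsWithin, IntegralSol.eventually_close (by positivity) hTT hL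
      (hL.self_of_nhdsWithin hp₀) (hΛ p₀ hp₀)
      (hneg.mono fun s hs => hs.adjointField hD hmodel hloss tendsto_const_nhds) hε]
      with p hp h i t ht
    exact (norm_le_pi_norm (Λ p (-t) - Λ p₀ (-t)) i).trans (h (Λ p) (hΛ p hp) _ (hmem i t ht))
  have hlamB : ∀ p₀ ∈ D.feasible P, ∃ A, 0 ≤ A ∧ ∀ᶠ p in 𝓝[D.feasible P] p₀, ∀ i,
      ∀ t ∈ Icc (D.tStart i) (D.tEnd i), ‖lam p i t‖ ≤ A := by
    intro p₀ hp₀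
    obtain ⟨A, hA⟩ := isCompact_Icc.exists_bound_of_continuousOn (s := Icc (-T) T)
      (hΛ p₀ hp₀).cont.continuousOn
    refine ⟨1 + |A|, by positivity, ?_⟩
    filter_upwards [hclose p₀ hp₀ 1 one_pos] with p hp i t ht
    have h1 := norm_le_norm_sub_add (lam p i t) (lam p₀ i t)
    have h2 := (norm_le_pi_norm (Λ p₀ (-t)) i).trans (hA _ (hmem i t ht))
    exact h1.trans (add_le_add (hp i t ht) (h2.trans (le_abs_self A)))
  have hgradB : ∀ p₀ ∈ D.feasible P, ∃ B, ∀ᶠ p in 𝓝[D.feasible P] p₀, ∀ i,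
      ∀ t ∈ Icc (D.tStart i) (D.tLead i), ‖D.gradAlong p (x p) (lam p) i t‖ ≤ B := by
    intro p₀ hp₀
    obtain ⟨A, hA0, hA⟩ := hlamB p₀ hp₀
    obtain ⟨B, hB0, hB, -⟩ := hlip p₀ hp₀
    refine ⟨A * B, ?_⟩
    filter_upwards [hA, hB] with p hA hB i t ht
    exact (ContinuousLinearMap.opNorm_comp_le _ _).trans (mul_le_mul (hA i t (hD.mem_Icc_end ht))
      (hB i t ht).2 (norm_nonneg _) hA0)
  have hgradInt : ∀ p ∈ D.feasible P, ∀ i,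
      IntervalIntegrable (D.gradAlong p (x p) (lam p) i) volume (D.tStart i) (D.tLead i) := by
    intro p hp i
    obtain ⟨Z, hZ, hlim⟩ := htime p hp
    obtain ⟨B, hB⟩ := hgradB p hp
    refine intervalIntegrable_of_continuousAt_off_finite hZ (hD.start_le_lead i)
      (fun t ht htZ => ?_) fun t ht => hB.self_of_nhdsWithin hp i t ht
    have hc : Continuous (lam p i) :=
      (continuous_apply i).comp ((hΛ p hp).cont.comp continuous_neg)
    exact (hlim t htZ (𝓝 t) _ tendsto_id).gradAlong hD hmodel (Ioo_subset_Icc_self ht)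
      (lam := fun _ => lam p) (hc.tendsto t)
  refine ⟨x, lam, fun p hp => ⟨hx p hp, fun y hy i t ht => ?_, ?_, fun mu hmu i t ht => ?_,
    hlossInt p hp, hgradInt p hp⟩, fun p₀ hp₀ => ?_, fun p₀ hp₀ => ?_⟩
  · exact Platoon.IsSimulated.unique hD hmodel hswitch hp hy (hx p hp) ht
  · obtain ⟨B, hB0, -, hL⟩ := hlip p hp
    exact Platoon.isAdjoint_of_integralSol hD hT (hL.self_of_nhdsWithin hp) (hΛ p hp)
  · obtain ⟨B, hB0, -, hL⟩ := hlip p hp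
    obtain ⟨M, hM, hmuM⟩ := Platoon.IsAdjoint.exists_integralSol hD hT hmu
    rw [hmuM i t ht, hM.unique (hL.self_of_nhdsWithin hp) (by positivity) (hΛ p hp) _
      (hmem i t ht)]
  · obtain ⟨B, hB0, hB, -⟩ := hlip p₀ hp₀
    refine tendsto_finsetSum _ fun i _ => ?_
    refine Platoon.continuousWithinAt_integral hD (fun p hp => hlossInt p hp i)
      (hB.mono fun p h t ht => (h i t ht).1) ?_
    filter_upwards [(hcont p₀ hp₀).ae_trajLimit hD hp₀ (hreg p₀ hp₀).1 (hreg p₀ hp₀).2] with t ht hi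
    exact ht.lossAlong hD hloss hi
  · obtain ⟨B, hB⟩ := hgradB p₀ hp₀
    refine tendsto_pi_nhds.2 fun i => Tendsto.neg ?_
    refine Platoon.continuousWithinAt_integral hD (fun p hp => hgradInt p hp i)
      (hB.mono fun p h t ht => h i t ht) ?_
    filter_upwards [(hcont p₀ hp₀).ae_trajLimit hD hp₀ (hreg p₀ hp₀).1 (hreg p₀ hp₀).2] with t ht hi
    refine ht.gradAlong hD hmodel hi (lam := lam) (lam₀ := lam p₀) ?_
    rw [Metric.tendsto_nhds]
    intro ε hε
    filter_upwards [hclose p₀ hp₀ (ε / 2) (by positivity)] with p hp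
    rw [dist_eq_norm]
    exact (hp i t (hD.mem_Icc_end hi)).trans_lt (by linarith)
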